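/- Let $\mathbb H_+=\{\zeta\in\mathbb C:\operatorname{Im}\zeta>0\}$ and let $\Gamma\subset\mathbb H_+$ be a compact simple regular $C^1$ arc (the injective image of a compact interval $[a,b]$, $a<b$, under a $C^1$ map with non-vanishing derivative; in particular not a closed curve). Let $L^2(\Gamma)=L^2(\Gamma,|d\tau|)$ be the space of complex-valued functions that are square integrable with respect to arc length, and let $H^2$ be the Hardy space of functions $f$ analytic in $\mathbb H_+$ with $\sup_{y>0}\|f(\cdot+iy)\|_{L^2(\mathbb R)}<\infty$, where $\|f\|_{H^2}$ is the $L^2(\mathbb R)$ norm of the boundary values of $f$. Let $z\in\mathbb H_+\setminus\Gamma$, and put $$(\mathcal K u)(\zeta)=\frac1{2\pi}\int_\Gamma\frac{i\,u(\tau)}{\zeta-\overline\tau}\,|d\tau|,\qquad p_z(\zeta)=\frac{i}{\zeta-\overline z}.$$ For every $\epsilon>0$ the equation $\mathcal K u+\epsilon^2u=p_z$ on $\Gamma$ has a unique solution $u=u_{\epsilon,z}\in L^2(\Gamma)$. For $\zeta\in\mathbb H_+\setminus\Gamma$ the value $u(\zeta)$ is defined by the same equation, $u(\zeta)=\epsilon^{-2}\bigl(p_z(\zeta)-(\mathcal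 K u)(\zeta)\bigr)$; this formula, used on all of $\mathbb H_+$, extends $u$ to a function in $H^2$, and $\|u\|_{H^2}$ is the norm of that function. Let $\{e_n\}_{n\ge1}$ be any orthonormal basis of $L^2(\Gamma)$ consisting of eigenfunctions of $\mathcal K$, $\mathcal K e_n=\lambda_ne_n$, and let $\pi_n=(p_z,e_n)_{L^2(\Gamma)}=\int_\Gamma p_z\,\overline{e_n}\,|d\tau|$. Then $\lambda_n>0$ for all $n$, and $$\sum_{n=1}^\infty\frac{|\pi_n|^2}{\lambda_n}=\frac{\pi}{\operatorname{Im}z},\qquad \sum_{n=1}^\infty\frac{|\pi_n|^2}{\lambda_n^2}=+\infty .$$ Moreover, for every $\epsilon>0$, $$2\pi u_{\epsilon,z}(z)=\sum_{n=1}^\infty\frac{|\pi_n|^2}{\lambda_n(\lambda_n+\epsilon^2)},\qquad \|u_{\epsilon,z}\|_{L^2(\Gamma)}^2=\sum_{n=1}^\infty\frac{|\pi_n|^2}{(\lambda_n+\epsilon^2)^2},\qquad \|u_{\epsilon,z}\|_{H^2}^2=\sum_{n=1}^\infty\frac{|\pi_n|^2}{\lambda_n(\lambda_n+\epsilon^2)^2},$$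 and consequently $$2\pi u_{\epsilon,z}(z)=\|u_{\epsilon,z}\|_{L^2(\Gamma)}^2+\epsilon^2\|u_{\epsilon,z}\|_{H^2}^2 .$$ -/

import Mathlib

open MeasureTheory Set Filter Topology
open scoped ENNReal NNReal ComplexConjugate

/-- `γ : [a, b] → ℂ` is a regular `C¹` parametrization of a compact simple arc (injective on the
closed interval, so the curve does not cross itself and is not closed). -/
structure IsC1Arc (γ : ℝ → ℂ) (a b : ℝ) : Prop where
  lt : a < b
  contDiffOn : ContDiffOn ℝ 1 γ (Icc a b)
  deriv_ne_zero : ∀ t ∈ Icc a b, derivWithin γ (Icc a b) t ≠ 0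
  injOn : InjOn γ (Icc a b)

/-- The arc length measure `|dτ|` of the curve: the image under `γ` of `|γ'(t)| dt` on `[a, b]`. -/
noncomputable def arcMeasure (γ : ℝ → ℂ) (a b : ℝ) : Measure ℂ :=
  ((volume.restrict (Icc a b)).withDensity
    (fun t => ENNReal.ofReal ‖derivWithin γ (Icc a b) t‖)).map γ

/-- `L²(Γ)`: complex valued functions, square integrable with respect to arc length. -/
noncomputable abbrev ArcL2 (γ : ℝ → ℂ) (a b : ℝ) := Lp ℂ 2 (arcMeasure γ a b)

/-- `(𝒦 u)(ζ) = (1 / 2π) ∫_Γ i u(τ) / (ζ - conj τ) |dτ|`. -/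
noncomputable def opK (γ : ℝ → ℂ) (a b : ℝ) (u : ℂ → ℂ) (ζ : ℂ) : ℂ :=
  1 / (2 * (Real.pi : ℂ)) * ∫ τ, Complex.I * u τ / (ζ - conj τ) ∂(arcMeasure γ a b)

/-- `p_z(ζ) = i / (ζ - conj z)`. -/
noncomputable def poleFn (z ζ : ℂ) : ℂ := Complex.I / (ζ - conj z)

/-- `u ∈ L²(Γ)` solves `𝒦 u + ε² u = p_z` in `L²(Γ)`, that is, almost everywhere on `Γ`. -/
def SolvesEq (γ : ℝ → ℂ) (a b : ℝ) (z : ℂ) (ε : ℝ) (u : ArcL2 γ a b) : Prop :=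
  ∀ᵐ ζ ∂(arcMeasure γ a b), opK γ a b u ζ + (ε : ℂ) ^ 2 * u ζ = poleFn z ζ

/-- The function that a solution `u ∈ L²(Γ)` of the integral equation defines off `Γ`, where the
equation is read as the definition of `u(ζ)`. -/
noncomputable def solutionExt (γ : ℝ → ℂ) (a b : ℝ) (z : ℂ) (ε : ℝ) (u : ArcL2 γ a b)
    (ζ : ℂ) : ℂ :=
  (poleFn z ζ - opK γ a b u ζ) / (ε : ℂ) ^ 2

/-- The orthonormal basis `e` of `L²(Γ)` consists of eigenfunctions of `𝒦`, with eigenvalues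
`lam`. -/
def IsEigenbasis (γ : ℝ → ℂ) (a b : ℝ) (e : HilbertBasis ℕ ℂ (ArcL2 γ a b)) (lam : ℕ → ℝ) :
    Prop :=
  ∀ n, ∀ᵐ ζ ∂(arcMeasure γ a b), opK γ a b (e n) ζ = (lam n : ℂ) * e n ζ

/-- `(p_z, v)_{L²(Γ)} = ∫_Γ p_z conj v |dτ|`. -/
noncomputable def poleCoeff (γ : ℝ → ℂ) (a b : ℝ) (z : ℂ) (v : ArcL2 γ a b) : ℂ :=
  ∫ τ, poleFn z τ * conj (v τ) ∂(arcMeasure γ a b)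

/-- The Hardy space `H²` of the upper half-plane. -/
def MemHardy (f : ℂ → ℂ) : Prop :=
  DifferentiableOn ℂ f {ζ | 0 < ζ.im} ∧
    ∃ C : ℝ≥0, ∀ y : ℝ, 0 < y →
      eLpNorm (fun x : ℝ => f ((x : ℂ) + (y : ℂ) * Complex.I)) 2 volume ≤ C

/-- The boundary values `lim_{y ↓ 0} f(x + i y)` on the real line (they exist for almost every
`x` if `f ∈ H²`). -/
noncomputable def boundaryValue (f : ℂ → ℂ) (x : ℝ) : ℂ :=
  limUnder (𝓝[>] (0 : ℝ)) (fun y : ℝ => f ((x : ℂ) + (y : ℂ) * Complex.I))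

/-- The norm of `H²`: the `L²(ℝ)` norm of the boundary values. -/
noncomputable def hardyNorm (f : ℂ → ℂ) : ℝ :=
  (eLpNorm (boundaryValue f) 2 volume).toReal

/-! The pole `p_w` is, up to the factor `2π`, the reproducing kernel of `H²`. Let `R` be the
operator that projects `L²(ℝ)` onto `H²` and restricts to `Γ` (`hardyRestrict`). By the reproducing
property, `R†u` is the boundary function of `𝒦u` (`coeFn_adjoint_hardyRestrict`), so `𝒦 = R R†` on
`L²(Γ)`. Write `p` for the boundary values of `p_z` (`linePole`). Since `p_z = R p` on `Γ`, the
integral equation is the Tikhonov equation `R R†u + ε²u = R p`, and the extension of `u` to the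
half-plane is the residual `U = ε⁻²(p - R†u)`, which satisfies `R U = u`.

Everything else is Hilbert space geometry. The vectors `R†e_n` are orthogonal, have square norm
`λ_n`, and span a dense subspace of `(ker R)ᗮ`. Parseval for this system, applied to the pairs `(p,
p)`, `(p, U)` and `(U, U)`, gives three of the series, and Parseval for `e_n` gives the series of
`‖u‖²`. The final identity comes from pairing `p = ε²U + R†u` with `U`.

Three facts from function theory are needed. (1) `p ∈ (ker R)ᗮ`: a Hardy function that vanishes
almost everywhere on `Γ` vanishes at `z`, by the identity theorem. (2) `R†` is injective, whence
`λ_n > 0`: if `𝒦u = 0` in the half-plane, the same holds off the reflected arc, because an arc does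
not separate the plane (`isPreconnected_compl_arc`). Then a Cauchy transform vanishes almost
everywhere, which forces `u = 0` (`ae_eq_zero_of_cauchyTransform_eq_zero`). (3) `p` is not in the
range of `R†`: `𝒦u` continues analytically across `conj z`, where `p_z` has its pole. By Picard's
criterion the series with `λ_n²` diverges. -/

/-! ### Plane topology: a simple arc does not separate the plane -/

/-- A nowhere vanishing continuous function on a real normed space has a continuous logarithm. -/
theorem exists_continuous_log {E : Type*} [NormedAddCommGroup E] [NormedSpace ℝ E] {f : E → ℂ}
    (hf : Continuous f) (h0 : ∀ x, f x ≠ 0) :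
    ∃ g : E → ℂ, Continuous g ∧ ∀ x, Complex.exp (g x) = f x := by
  have : IsSimplyConnected (univ : Set E) := by
    have : ContractibleSpace (univ : Set E) := convex_univ.contractibleSpace ⟨0, trivial⟩
    unfold IsSimplyConnected
    infer_instance
  obtain ⟨g, hg, hgf⟩ := Complex.exists_continuousOn_eqOn_exp_comp this isOpen_univ hf.continuousOn
    (by rintro ⟨x, -, hx⟩; exact h0 x hx)
  exact ⟨g, continuousOn_univ.1 hg, fun x => hgf (mem_univ x)⟩

/-- There is no continuous logarithm on a circle. -/
theorem not_exists_log_on_circle {g : ℂ → ℂ} (hg : Continuous g) {R : ℝ} (hR : 0 < R)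
    (h : ∀ w : ℂ, ‖w‖ = R → Complex.exp (g w) = w) : False := by
  set θ : ℝ → ℝ := fun t =>
    ((g (R * Complex.exp (t * Complex.I))).im - t) / (2 * Real.pi) with hθ
  have hcont : Continuous θ := by fun_prop
  have hint : ∀ t, ∃ n : ℤ, θ t = n := by
    intro t
    have h1 := h (R * Complex.exp (t * Complex.I)) (by
      rw [norm_mul, Complex.norm_exp_ofReal_mul_I]; simp [abs_of_pos hR])
    have h2 : Complex.exp (g (R * Complex.exp (t * Complex.I))) =
        Complex.exp (Real.log R + t * Complex.I) := by
      rw [h1, Complex.exp_add, ← Complex.ofReal_exp, Real.exp_log hR]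
    obtain ⟨n, hn⟩ := Complex.exp_eq_exp_iff_exists_int.1 h2
    refine ⟨n, ?_⟩
    simp only [hθ]
    rw [hn]
    simp
  -- Going round the circle once returns `g` to its initial value while `t` grows by `2π`. Thus an
  -- integer valued continuous function changes by one, and it would have to pass through a
  -- half-integer.
  have h2π : θ (2 * Real.pi) = θ 0 - 1 := by
    simp only [hθ]
    have : Complex.exp (((2 * Real.pi : ℝ) : ℂ) * Complex.I) = 1 := by
      push_cast; exact Complex.exp_two_pi_mul_I
    rw [this]
    simp
    field_simp
  obtain ⟨n, hn⟩ := hint 0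
  have hmem : θ 0 - 1 / 2 ∈ Icc (θ (2 * Real.pi)) (θ 0) := by
    rw [h2π]; constructor <;> linarith
  obtain ⟨t, -, ht⟩ := intermediate_value_Icc' (by positivity : (0 : ℝ) ≤ 2 * Real.pi)
    hcont.continuousOn hmem
  obtain ⟨m, hm⟩ := hint t
  rw [hm, hn] at ht
  have : (2 * m : ℝ) = 2 * n - 1 := by linarith
  have : 2 * m = 2 * n - 1 := by exact_mod_cast this
  omega

/-- A bounded open set whose frontier lies on a simple arc is empty. -/
theorem eq_empty_of_frontier_subset_arc {γ : ℝ → ℂ} {a b : ℝ} (hab : a ≤ b)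
    (hc : ContinuousOn γ (Icc a b)) (hinj : InjOn γ (Icc a b)) {Ω : Set ℂ}
    (hb : Bornology.IsBounded Ω) (hfr : frontier Ω ⊆ γ '' Icc a b)
    (hdisj : Disjoint Ω (γ '' Icc a b)) : Ω = ∅ := by
  by_contra hne
  obtain ⟨c, hcΩ⟩ := nonempty_iff_ne_empty.2 hne
  have hcγ : ∀ t ∈ Icc a b, γ t - c ≠ 0 := fun t ht h0 =>
    disjoint_left.1 hdisj hcΩ ⟨t, ht, sub_eq_zero.1 h0⟩
  obtain ⟨l, hl, hlexp⟩ := exists_continuous_log (f := fun s : ℝ => γ (projIcc a b hab s) - c)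
    ((hc.domRestrict.comp continuous_projIcc).sub continuous_const)
    (fun s => hcγ _ (projIcc a b hab s).2)
  have hemb : IsClosedEmbedding (fun t : Icc a b => γ t) :=
    hc.domRestrict.isClosedEmbedding (fun s t h => Subtype.ext (hinj s.2 t.2 h))
  -- Tietze: the logarithm of `w - c` along the arc extends to the whole plane.
  obtain ⟨G, hG⟩ := ContinuousMap.exists_extension' hemb
    ⟨fun t : Icc a b => l t, hl.comp continuous_subtype_val⟩
  have hG' : ∀ t ∈ Icc a b, Complex.exp (G (γ t)) = γ t - c := by
    intro t ht
    have h1 : G (γ t) = l t := congrFun hG ⟨t, ht⟩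
    rw [h1, hlexp, projIcc_of_mem hab ht]
  classical
  -- The two pieces agree on the frontier, which lies on the arc. The only zero of `w - c` is in
  -- `Ω`, where it is replaced by an exponential. So `h` has a global logarithm, although it equals
  -- `w - c` on large circles.
  set h : ℂ → ℂ := Ω.piecewise (fun w => Complex.exp (G w)) (fun w => w - c) with hh
  have hcont : Continuous h := by
    refine Continuous.piecewise ?_ (by fun_prop) (by fun_prop)
    intro w hw
    obtain ⟨t, ht, rfl⟩ := hfr hw
    exact hG' t ht
  have hne0 : ∀ w, h w ≠ 0 := by
    intro w
    by_cases hw : w ∈ Ω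
    · rw [hh, piecewise_eq_of_mem _ _ _ hw]; exact Complex.exp_ne_zero _
    · rw [hh, piecewise_eq_of_notMem _ _ _ hw]
      intro h0
      exact hw (sub_eq_zero.1 h0 ▸ hcΩ)
  obtain ⟨g, hg, hgexp⟩ := exists_continuous_log (f := fun w => h (c + w))
    (hcont.comp (by fun_prop)) (fun w => hne0 _)
  obtain ⟨R, hR, hΩR⟩ := hb.subset_ball_lt 0 c
  refine not_exists_log_on_circle hg hR fun w hw => ?_
  rw [hgexp, hh, piecewise_eq_of_notMem _ _ _, add_sub_cancel_left]
  intro hmem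
  have := hΩR hmem
  simp [hw] at this

/-- The exterior of a disc is connected. -/
theorem isPreconnected_setOf_le_norm (R : ℝ) (hR : 0 ≤ R) :
    IsPreconnected {w : ℂ | R ≤ ‖w‖} := by
  have himg : {w : ℂ | R ≤ ‖w‖} = (fun p : ℝ × ℂ => (p.1 : ℂ) * p.2) ''
      (Ici R ×ˢ Metric.sphere (0 : ℂ) 1) := by
    ext w
    constructor
    · intro hw
      by_cases h0 : w = 0
      · subst h0
        have hR0 : R = 0 := le_antisymm (by simpa using hw) hR
        exact ⟨(0, 1), ⟨by simp [hR0], by simp⟩, by simp⟩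
      · refine ⟨(‖w‖, w / ‖w‖), ⟨hw, by simp [h0]⟩, ?_⟩
        have : (‖w‖ : ℂ) ≠ 0 := by simpa using h0
        field_simp
    · rintro ⟨⟨r, v⟩, ⟨hr, hv⟩, rfl⟩
      have hr' : R ≤ r := hr
      have hv' : ‖v‖ = 1 := by simpa using hv
      simp only [mem_ofPred_eq, norm_mul, hv', mul_one, Complex.norm_real, Real.norm_eq_abs]
      exact hr'.trans (le_abs_self r)
  rw [himg]
  refine IsPreconnected.image ?_ _ (by fun_prop)
  exact isPreconnected_Ici.prod (isPreconnected_sphere (by simp) 0 1)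

/-- A simple arc does not separate the plane. -/
theorem isPreconnected_compl_arc {γ : ℝ → ℂ} {a b : ℝ} (hab : a ≤ b)
    (hc : ContinuousOn γ (Icc a b)) (hinj : InjOn γ (Icc a b)) :
    IsPreconnected (γ '' Icc a b)ᶜ := by
  set Γ := γ '' Icc a b with hΓ
  have hcomp : IsCompact Γ := isCompact_Icc.image_of_continuousOn hc
  have hopen : IsOpen Γᶜ := hcomp.isClosed.isOpen_compl
  obtain ⟨R, hR, hΓR⟩ := hcomp.isBounded.subset_ball_lt 0 0
  set E : Set ℂ := {w : ℂ | R ≤ ‖w‖}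
  have hE : E ⊆ Γᶜ := fun w hw hwΓ => by
    have := hΓR hwΓ
    simp only [Metric.mem_ball, dist_zero_right] at this
    exact absurd this (not_lt.2 hw)
  have hRE : (R : ℂ) ∈ E := by simp [E, abs_of_pos hR]
  -- A component that misses the exterior of the disc would be bounded and open with frontier on the
  -- arc, hence empty.
  have key : ∀ w ∈ Γᶜ, (R : ℂ) ∈ connectedComponentIn Γᶜ w := by
    intro w hw
    set C := connectedComponentIn Γᶜ w with hC
    have hCopen : IsOpen C := hopen.connectedComponentIn
    by_cases hCE : (C ∩ E).Nonempty
    · obtain ⟨v, hvC, hvE⟩ := hCE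
      have := (isPreconnected_setOf_le_norm R hR.le).subset_connectedComponentIn hvE hE hRE
      rwa [hC, connectedComponentIn_eq hvC]
    · exfalso
      have hbd : C ⊆ Metric.ball 0 R := fun v hv => by
        by_contra hvR
        exact hCE ⟨v, hv, by simpa [E] using hvR⟩
      have hfr : frontier C ⊆ Γ := by
        intro y hy
        by_contra hyΓ
        obtain ⟨v, hv1, hv2⟩ := mem_closure_iff.1 hy.1 _ hopen.connectedComponentIn
          (mem_connectedComponentIn hyΓ)
        have h1 := connectedComponentIn_eq hv1
        have h2 := connectedComponentIn_eq hv2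
        have : y ∈ C := by
          rw [hC, h2, ← h1]; exact mem_connectedComponentIn hyΓ
        exact hy.2 (hCopen.interior_eq.symm ▸ this)
      have := eq_empty_of_frontier_subset_arc hab hc hinj
        (Metric.isBounded_ball.subset hbd) hfr
        (disjoint_left.2 fun v hv => connectedComponentIn_subset _ _ hv)
      exact (this ▸ mem_connectedComponentIn hw : w ∈ (∅ : Set ℂ))
  have : Γᶜ = connectedComponentIn Γᶜ (R : ℂ) := by
    refine Subset.antisymm (fun w hw => ?_) (connectedComponentIn_subset _ _)
    rw [← connectedComponentIn_eq (key w hw)]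
    exact mem_connectedComponentIn hw
  rw [this]
  exact isPreconnected_connectedComponentIn

/-! ### Uniqueness for Cauchy transforms -/

/-- The function `w ↦ w / |w|` cut off outside the disc of radius `R`. -/
noncomputable def radialUnit (R : ℝ) : ℂ → ℂ :=
  (Metric.ball (0 : ℂ) R).indicator fun w => w / ‖w‖

theorem measurable_radialUnit (R : ℝ) : Measurable (radialUnit R) := by
  unfold radialUnit
  exact Measurable.indicator (by fun_prop) measurableSet_ball

theorem norm_radialUnit_le (R : ℝ) (w : ℂ) :
    ‖radialUnit R w‖ ≤ (Metric.ball (0 : ℂ) R).indicator (fun _ => (1 : ℝ)) w := by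
  unfold radialUnit
  by_cases hw : w ∈ Metric.ball (0 : ℂ) R
  · rw [indicator_of_mem hw, indicator_of_mem hw]
    simp only [norm_div, Complex.norm_real, norm_norm]
    exact div_self_le_one _
  · simp [indicator_of_notMem hw]

theorem integrable_indicator_ball_inv_norm :
    Integrable ((Metric.ball (0 : ℂ) 1).indicator fun w => ‖w‖⁻¹) := by
  rw [integrable_indicator_iff measurableSet_ball]
  refine integrableOn_ball_of_norm_le_rpow (α := 1) (C := 1) (by simp) (by simp) ?_
    (by fun_prop)
  refine Eventually.of_forall fun w => ?_
  simp [Real.rpow_neg_one]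

/-- A dominating function for the radially cut off Cauchy kernel. -/
theorem norm_radialUnit_div_le (R : ℝ) (τ w : ℂ) :
    ‖radialUnit R w / (w - τ)‖ ≤ (Metric.ball (0 : ℂ) 1).indicator (fun w => ‖w‖⁻¹) (w - τ) +
      (Metric.ball (0 : ℂ) R).indicator (fun _ => (1 : ℝ)) w := by
  have h1 := norm_radialUnit_le R w
  have h0 : (Metric.ball (0 : ℂ) R).indicator (fun _ => (1 : ℝ)) w ≤ 1 :=
    indicator_le_self' (fun _ _ => zero_le_one) w
  have h00 : 0 ≤ (Metric.ball (0 : ℂ) R).indicator (fun _ => (1 : ℝ)) w :=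
    indicator_nonneg (fun _ _ => zero_le_one) w
  rw [norm_div, div_eq_mul_inv]
  by_cases hw : w - τ ∈ Metric.ball (0 : ℂ) 1
  · rw [indicator_of_mem hw]
    have : ‖radialUnit R w‖ * ‖w - τ‖⁻¹ ≤ 1 * ‖w - τ‖⁻¹ := by gcongr; linarith
    linarith
  · rw [indicator_of_notMem hw, zero_add]
    have : 1 ≤ ‖w - τ‖ := by simpa using hw
    calc ‖radialUnit R w‖ * ‖w - τ‖⁻¹ ≤ ‖radialUnit R w‖ * 1 := by
          gcongr; exact inv_le_one_of_one_le₀ this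
      _ ≤ _ := by linarith

theorem integrable_radialUnit_bound (R : ℝ) (τ : ℂ) :
    Integrable fun w => (Metric.ball (0 : ℂ) 1).indicator (fun w => ‖w‖⁻¹) (w - τ) +
      (Metric.ball (0 : ℂ) R).indicator (fun _ => (1 : ℝ)) w := by
  refine (integrable_indicator_ball_inv_norm.comp_sub_right τ).add ?_
  rw [integrable_indicator_iff measurableSet_ball]
  exact integrableOn_const (by finiteness)

theorem measurable_radialUnit_div (R : ℝ) (τ : ℂ) :
    Measurable fun w => radialUnit R w / (w - τ) :=
  (measurable_radialUnit R).div (by fun_prop)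

theorem integrable_radialUnit_div (R : ℝ) (τ : ℂ) :
    Integrable fun w => radialUnit R w / (w - τ) :=
  (integrable_radialUnit_bound R τ).mono' (measurable_radialUnit_div R τ).aestronglyMeasurable
    (Eventually.of_forall (norm_radialUnit_div_le R τ))

/-- Translation invariance makes the bound uniform in the pole `τ`, as Fubini requires below. -/
theorem integral_norm_radialUnit_div_le (R : ℝ) : ∃ C, ∀ τ,
    ∫ w, ‖radialUnit R w / (w - τ)‖ ≤ C := by
  refine ⟨(∫ w, (Metric.ball (0 : ℂ) 1).indicator (fun w => ‖w‖⁻¹) w) +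
    ∫ w, (Metric.ball (0 : ℂ) R).indicator (fun _ => (1 : ℝ)) w, fun τ => ?_⟩
  calc _ ≤ ∫ w, ((Metric.ball (0 : ℂ) 1).indicator (fun w => ‖w‖⁻¹) (w - τ) +
      (Metric.ball (0 : ℂ) R).indicator (fun _ => (1 : ℝ)) w) :=
        integral_mono (integrable_radialUnit_div R τ).norm (integrable_radialUnit_bound R τ)
          (norm_radialUnit_div_le R τ)
    _ = _ := by
      rw [integral_add (integrable_indicator_ball_inv_norm.comp_sub_right τ)]
      · rw [integral_sub_right_eq_self
          ((Metric.ball (0 : ℂ) 1).indicator fun w => ‖w‖⁻¹) τ]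
      · rw [integrable_indicator_iff measurableSet_ball]
        exact integrableOn_const (by finiteness)

/-- Multiplied by `i`, this is the contour integral of `1 / (w - τ)` over the circle of radius `r`.
-/
theorem integral_circle_cauchy_kernel {r : ℝ} (hr : 0 < r) {τ : ℂ} (hτ : r ≠ ‖τ‖) :
    ∫ θ in Ioo (-Real.pi) Real.pi, (r : ℂ) * Complex.exp (θ * Complex.I) /
      (r * Complex.exp (θ * Complex.I) - τ) = if ‖τ‖ < r then 2 * (Real.pi : ℂ) else 0 := by
  have hper : Function.Periodic (fun θ : ℝ => (r : ℂ) * Complex.exp (θ * Complex.I) /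
      (r * Complex.exp (θ * Complex.I) - τ)) (2 * Real.pi) := by
    intro θ
    have : Complex.exp (((θ + 2 * Real.pi : ℝ) : ℂ) * Complex.I) =
        Complex.exp (θ * Complex.I) := by
      push_cast
      rw [add_mul, Complex.exp_add, Complex.exp_two_pi_mul_I, mul_one]
    simp only [this]
  have h1 : ∫ θ in Ioo (-Real.pi) Real.pi, (r : ℂ) * Complex.exp (θ * Complex.I) /
      (r * Complex.exp (θ * Complex.I) - τ) =
      ∫ θ in (0 : ℝ)..(2 * Real.pi), (r : ℂ) * Complex.exp (θ * Complex.I) /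
      (r * Complex.exp (θ * Complex.I) - τ) := by
    rw [← integral_Ioc_eq_integral_Ioo, ← intervalIntegral.integral_of_le
      (by linarith [Real.pi_pos])]
    have := hper.intervalIntegral_add_eq (-Real.pi) 0
    rw [show -Real.pi + 2 * Real.pi = Real.pi by ring, zero_add] at this
    exact this
  have h2 : (∮ w in C(0, r), (w - τ)⁻¹) = Complex.I *
      ∫ θ in (0 : ℝ)..(2 * Real.pi), (r : ℂ) * Complex.exp (θ * Complex.I) /
      (r * Complex.exp (θ * Complex.I) - τ) := by
    rw [circleIntegral, ← intervalIntegral.integral_const_mul]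
    congr 1
    ext θ
    simp only [deriv_circleMap, circleMap, zero_add, smul_eq_mul]
    ring
  rw [h1]
  have hI : Complex.I ≠ 0 := Complex.I_ne_zero
  split_ifs with h
  · rw [circleIntegral.integral_sub_inv_of_mem_ball (by simpa using h)] at h2
    apply mul_left_cancel₀ hI
    rw [← h2]; ring
  · have hlt : r < ‖τ‖ := lt_of_le_of_ne (not_lt.1 h) hτ
    have hne : ∀ w ∈ Metric.closedBall (0 : ℂ) r, w - τ ≠ 0 := by
      intro w hw h0
      rw [sub_eq_zero.1 h0] at hw
      simp at hw
      linarith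
    have : (∮ w in C(0, r), (w - τ)⁻¹) = 0 := by
      refine DiffContOnCl.circleIntegral_eq_zero hr.le (DifferentiableOn.diffContOnCl ?_)
      rw [closure_ball _ hr.ne']
      exact DifferentiableOn.inv (by fun_prop) hne
    rw [this] at h2
    exact (mul_eq_zero.1 h2.symm).resolve_left hI

/-- In polar coordinates the Jacobian `r` and the factor `w / |w|` combine to `w`. Each circle of
radius between `‖τ‖` and `R` then contributes `2π`, and the other circles (apart from the null
radius `‖τ‖`) contribute nothing. -/
theorem integral_radialUnit_div (R : ℝ) (τ : ℂ) :
    ∫ w, radialUnit R w / (w - τ) = 2 * Real.pi * (max (R - ‖τ‖) 0 : ℝ) := by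
  have hint := integrable_radialUnit_div R τ
  set F : ℂ → ℂ := fun w => radialUnit R w / (w - τ) with hF
  have hFm : Measurable F := measurable_radialUnit_div R τ
  have hexp : ∀ p : ℝ × ℝ, Complex.polarCoord.symm p = p.1 * Complex.exp (p.2 * Complex.I) := by
    intro p
    rw [Complex.polarCoord_symm_apply, Complex.exp_mul_I, Complex.ofReal_cos, Complex.ofReal_sin]
  have hcontpolar : Measurable fun p : ℝ × ℝ => Complex.polarCoord.symm p := by
    simp only [hexp]
    fun_prop
  have hprod : IntegrableOn (fun p : ℝ × ℝ => p.1 • F (Complex.polarCoord.symm p))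
      (Ioi 0 ×ˢ Ioo (-Real.pi) Real.pi) := by
    refine ⟨(measurable_fst.smul (hFm.comp hcontpolar)).aestronglyMeasurable, ?_⟩
    have h1 := Complex.lintegral_comp_polarCoord_symm fun w => ‖F w‖ₑ
    have h2 : ∫⁻ w, ‖F w‖ₑ < ⊤ := hint.2
    rw [← h1] at h2
    refine lt_of_le_of_lt (le_of_eq ?_) h2
    refine setLIntegral_congr_fun (measurableSet_Ioi.prod measurableSet_Ioo) fun p hp => ?_
    simp only [enorm_smul, smul_eq_mul]
    rw [Real.enorm_of_nonneg (le_of_lt hp.1)]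
  rw [← Complex.integral_comp_polarCoord_symm]
  change ∫ p in Ioi 0 ×ˢ Ioo (-Real.pi) Real.pi, p.1 • F (Complex.polarCoord.symm p) = _
  rw [Measure.volume_eq_prod, setIntegral_prod _ hprod]
  have hinner : ∀ᵐ r : ℝ ∂(volume.restrict (Ioi 0)),
      ∫ θ in Ioo (-Real.pi) Real.pi, r • F (Complex.polarCoord.symm (r, θ)) =
        (Ioo ‖τ‖ R).indicator (fun _ => 2 * (Real.pi : ℂ)) r := by
    have hne : ∀ᵐ r : ℝ ∂(volume.restrict (Ioi 0)), r ≠ ‖τ‖ :=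
      ae_restrict_of_ae (Measure.ae_ne volume ‖τ‖)
    filter_upwards [hne, ae_restrict_mem measurableSet_Ioi] with r hr hr0
    have hr0 : 0 < r := hr0
    by_cases hrR : r < R
    · have : ∀ θ : ℝ, r • F (Complex.polarCoord.symm (r, θ)) =
          (r : ℂ) * Complex.exp (θ * Complex.I) / (r * Complex.exp (θ * Complex.I) - τ) := by
        intro θ
        have hn : ‖(r : ℂ) * Complex.exp (θ * Complex.I)‖ = r := by
          rw [norm_mul, Complex.norm_exp_ofReal_mul_I]; simp [abs_of_pos hr0]
        have hr0' : (r : ℂ) ≠ 0 := by exact_mod_cast hr0.ne'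
        simp only [hexp, hF, radialUnit]
        rw [indicator_of_mem (by simp only [Metric.mem_ball, dist_zero_right]; rw [hn]; exact hrR),
          hn,
          Complex.real_smul]
        field_simp
      simp only [this]
      rw [integral_circle_cauchy_kernel hr0 hr]
      by_cases h : ‖τ‖ < r
      · rw [if_pos h, indicator_of_mem (show r ∈ Ioo ‖τ‖ R from ⟨h, hrR⟩)]
      · rw [if_neg h, indicator_of_notMem (s := Ioo ‖τ‖ R) fun h' => h h'.1]
    · rw [indicator_of_notMem (s := Ioo ‖τ‖ R) fun h' => hrR h'.2]
      have : ∀ θ : ℝ, r • F (Complex.polarCoord.symm (r, θ)) = 0 := by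
        intro θ
        have hn : ‖(r : ℂ) * Complex.exp (θ * Complex.I)‖ = r := by
          rw [norm_mul, Complex.norm_exp_ofReal_mul_I]; simp [abs_of_pos hr0]
        simp only [hexp, hF, radialUnit]
        rw [indicator_of_notMem
          (by simp only [Metric.mem_ball, dist_zero_right]; rw [hn]; exact hrR)]
        simp
      simp only [this, integral_zero]
  rw [integral_congr_ae hinner, integral_indicator measurableSet_Ioo, Measure.restrict_restrict
    measurableSet_Ioo, inter_eq_self_of_subset_left, setIntegral_const]
  · simp [Measure.real, mul_comm, ENNReal.toReal_ofReal']
  · intro r hr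
    exact lt_of_le_of_lt (norm_nonneg τ) hr.1

/-- An integrable density whose Cauchy transform vanishes almost everywhere vanishes almost
everywhere. -/
theorem ae_eq_zero_of_cauchyTransform_eq_zero {μ : Measure ℂ} [IsFiniteMeasure μ] {f : ℂ → ℂ}
    (hf : Integrable f μ) (h : ∀ᵐ w : ℂ, ∫ τ, f τ / (w - τ) ∂μ = 0) : f =ᵐ[μ] 0 := by
  -- Integrating the vanishing Cauchy transform against `radialUnit` centred at `c` and exchanging
  -- the integrals tests `f` against a cone.
  have hcone : ∀ (c : ℂ) (R : ℝ), ∫ τ, ((max (R - ‖τ - c‖) 0 : ℝ) : ℂ) * f τ ∂μ = 0 := by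
    intro c R
    obtain ⟨C, hC⟩ := integral_norm_radialUnit_div_le R
    have hm : AEStronglyMeasurable
        (fun p : ℂ × ℂ => f p.1 * (radialUnit R p.2 / (p.2 - (p.1 - c)))) (μ.prod volume) := by
      refine hf.1.comp_fst.mul (Measurable.aestronglyMeasurable ?_)
      exact ((measurable_radialUnit R).comp measurable_snd).div (by fun_prop)
    have hprod : Integrable
        (fun p : ℂ × ℂ => f p.1 * (radialUnit R p.2 / (p.2 - (p.1 - c)))) (μ.prod volume) := by
      rw [integrable_prod_iff hm]
      refine ⟨Eventually.of_forall fun τ => (integrable_radialUnit_div R (τ - c)).const_mul (f τ),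
        ?_⟩
      refine (hf.norm.mul_const C).mono' hm.norm.integral_prod_right' ?_
      refine Eventually.of_forall fun τ => ?_
      simp only [norm_mul, integral_const_mul]
      rw [norm_norm, Real.norm_of_nonneg (integral_nonneg fun _ => norm_nonneg _)]
      exact mul_le_mul_of_nonneg_left (hC _) (norm_nonneg _)
    have hswap := integral_integral_swap (f := fun τ w => f τ * (radialUnit R w / (w - (τ - c))))
      hprod
    have hzero : ∫ w, ∫ τ, f τ * (radialUnit R w / (w - (τ - c))) ∂μ = 0 := by
      have hc : ∀ᵐ w : ℂ, ∫ τ, f τ / (w + c - τ) ∂μ = 0 :=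
        (measurePreserving_add_right volume c).quasiMeasurePreserving.ae h
      refine integral_eq_zero_of_ae ?_
      filter_upwards [hc] with w hw
      have : ∀ τ, f τ * (radialUnit R w / (w - (τ - c))) =
          radialUnit R w * (f τ / (w + c - τ)) := fun τ => by
        rw [show w - (τ - c) = w + c - τ by ring]; ring
      simp only [this, integral_const_mul, hw, mul_zero, Pi.zero_apply]
    rw [hzero] at hswap
    simp only [integral_const_mul, integral_radialUnit_div] at hswap
    have h2 : ∀ τ, f τ * (2 * (Real.pi : ℂ) * ((max (R - ‖τ - c‖) 0 : ℝ) : ℂ)) =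
        (2 * (Real.pi : ℂ)) * (((max (R - ‖τ - c‖) 0 : ℝ) : ℂ) * f τ) := fun τ => by ring
    simp only [h2, integral_const_mul] at hswap
    exact (mul_eq_zero.1 hswap).resolve_left (by simp [Real.pi_ne_zero])
  have hball : ∀ (c : ℂ) (R : ℝ), ∫ τ in Metric.closedBall c R, f τ ∂μ = 0 := by
    intro c R
    -- Difference quotients of cones in the radius are bounded by `1` and tend to the indicator of
    -- the closed ball.
    set F : ℕ → ℂ → ℂ := fun n τ =>
      (((n + 1 : ℝ) * (max (R + 1 / (n + 1) - ‖τ - c‖) 0 - max (R - ‖τ - c‖) 0) : ℝ) : ℂ) * f τ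
      with hF
    have hcont : ∀ S : ℝ, Integrable (fun τ => ((max (S - ‖τ - c‖) 0 : ℝ) : ℂ) * f τ) μ := by
      intro S
      refine hf.bdd_mul (c := |S|) (by fun_prop) (Eventually.of_forall fun τ => ?_)
      rw [Complex.norm_real, Real.norm_of_nonneg (le_max_right _ _)]
      refine max_le ?_ (abs_nonneg _)
      linarith [norm_nonneg (τ - c), le_abs_self S]
    have hzero : ∀ n, ∫ τ, F n τ ∂μ = 0 := by
      intro n
      have : ∀ τ, F n τ = (n + 1 : ℂ) *
          (((max (R + 1 / (n + 1) - ‖τ - c‖) 0 : ℝ) : ℂ) * f τ -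
            ((max (R - ‖τ - c‖) 0 : ℝ) : ℂ) * f τ) := fun τ => by
        simp only [hF]; push_cast; ring
      simp only [this]
      rw [integral_const_mul, integral_sub (hcont _) (hcont _), hcone, hcone]
      simp
    have hbd : ∀ n τ, ‖F n τ‖ ≤ ‖f τ‖ := by
      intro n τ
      simp only [hF, norm_mul]
      refine mul_le_of_le_one_left (norm_nonneg _) ?_
      have hn : (0 : ℝ) < n + 1 := by positivity
      have h1 : max (R - ‖τ - c‖) 0 ≤ max (R + 1 / (n + 1) - ‖τ - c‖) 0 := by
        have : (0 : ℝ) < 1 / (n + 1) := by positivity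
        gcongr; linarith
      have h2 : max (R + 1 / (n + 1) - ‖τ - c‖) 0 ≤ max (R - ‖τ - c‖) 0 + 1 / (n + 1 : ℝ) := by
        refine max_le ?_ ?_
        · linarith [le_max_left (R - ‖τ - c‖) 0]
        · have := le_max_right (R - ‖τ - c‖) 0
          positivity
      rw [Complex.norm_real, Real.norm_of_nonneg (mul_nonneg hn.le (sub_nonneg.2 h1))]
      calc (n + 1 : ℝ) * (max (R + 1 / (n + 1) - ‖τ - c‖) 0 - max (R - ‖τ - c‖) 0)
          ≤ (n + 1) * (1 / (n + 1)) := by gcongr; linarith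
        _ = 1 := by field_simp
    have hlim : ∀ τ, Tendsto (fun n => F n τ) atTop
        (𝓝 ((Metric.closedBall c R).indicator f τ)) := by
      intro τ
      by_cases hτ : τ ∈ Metric.closedBall c R
      · have hle : ‖τ - c‖ ≤ R := by simpa [dist_eq_norm] using hτ
        rw [indicator_of_mem hτ]
        refine tendsto_const_nhds.congr fun n => ?_
        have hn : (0 : ℝ) < n + 1 := by positivity
        have hn' : (0 : ℝ) < 1 / (n + 1) := by positivity
        simp only [hF]
        rw [max_eq_left (by linarith), max_eq_left (by linarith)]
        have : ((n : ℝ) + 1) * (R + 1 / (n + 1) - ‖τ - c‖ - (R - ‖τ - c‖)) = 1 := by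
          field_simp; ring
        rw [this]; simp
      · have hgt : R < ‖τ - c‖ := by simpa [dist_eq_norm] using hτ
        rw [indicator_of_notMem hτ]
        have hev : ∀ᶠ n : ℕ in atTop, (1 / ((n : ℝ) + 1)) < ‖τ - c‖ - R :=
          tendsto_one_div_add_atTop_nhds_zero_nat.eventually_lt_const (by linarith)
        refine tendsto_const_nhds.congr' ?_
        filter_upwards [hev] with n hn
        simp only [hF]
        rw [max_eq_right (by linarith), max_eq_right (by linarith)]
        simp
    have hlim2 := tendsto_integral_of_dominated_convergence (fun τ => ‖f τ‖) (F := F)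
      (f := (Metric.closedBall c R).indicator f) (μ := μ)
      (fun n => by
        simp only [hF]
        exact AEStronglyMeasurable.mul (by fun_prop) hf.1) hf.norm
      (fun n => Eventually.of_forall (hbd n)) (Eventually.of_forall hlim)
    simp only [hzero] at hlim2
    rw [← integral_indicator measurableSet_closedBall]
    exact tendsto_nhds_unique hlim2 tendsto_const_nhds
  -- All averages over balls vanish, so the differentiation theorem for `μ` gives `f = 0` almost
  -- everywhere.
  filter_upwards [(Besicovitch.vitaliFamily μ).ae_tendsto_average hf.locallyIntegrable] with x hx
  have h1 := hx.comp (Besicovitch.tendsto_filterAt μ x)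
  refine tendsto_nhds_unique h1 (tendsto_const_nhds.congr fun r => ?_)
  simp [setAverage_eq, hball]

/-! ### Regularized normal equations and Picard's criterion in Hilbert space -/

section HilbertSpace

open ContinuousLinearMap
open scoped InnerProductSpace InnerProduct

variable {E F : Type*} [NormedAddCommGroup E] [InnerProductSpace ℂ E] [CompleteSpace E]
  [NormedAddCommGroup F] [InnerProductSpace ℂ F] [CompleteSpace F]

/-- The Tikhonov regularized normal equation is uniquely solvable. -/
theorem existsUnique_regularized (R : F →L[ℂ] E) {ε : ℝ} (hε : 0 < ε) (f : E) :
    ∃! u : E, R ((adjoint R) u) + (ε : ℂ) ^ 2 • u = f := by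
  set A : E →L[ℂ] E := R ∘L (adjoint R) + ((ε : ℂ) ^ 2) • ContinuousLinearMap.id ℂ E with hA
  have hunit : IsUnit A := by
    refine isUnit_of_forall_le_norm_inner_map A (c := Real.toNNReal (ε ^ 2))
      (Real.toNNReal_pos.2 (pow_pos hε 2)) fun x => ?_
    have h1 : ⟪A x, x⟫_ℂ = ((‖(adjoint R) x‖ ^ 2 + ε ^ 2 * ‖x‖ ^ 2 : ℝ) : ℂ) := by
      simp only [hA, add_apply, comp_apply, smul_apply, coe_id', id_eq, inner_add_left,
        inner_smul_left]
      rw [← adjoint_inner_right, inner_self_eq_norm_sq_to_K, inner_self_eq_norm_sq_to_K]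
      simp
    rw [h1, Complex.norm_real, Real.norm_of_nonneg (by positivity)]
    rw [Real.coe_toNNReal _ (sq_nonneg ε)]
    nlinarith [sq_nonneg ‖(adjoint R) x‖]
  obtain ⟨u, hu, huniq⟩ := (isUnit_iff_bijective.1 hunit).existsUnique f
  exact ⟨u, hu, fun v hv => huniq v hv⟩

/-- The residual `ε⁻² (p - (adjoint R) u)` of a regularized normal equation. -/
theorem map_residual {R : F →L[ℂ] E} {ε : ℝ} (hε : 0 < ε) {p : F} {u : E}
    (hu : R ((adjoint R) u) + (ε : ℂ) ^ 2 • u = R p) :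
    R (((ε : ℂ) ^ 2)⁻¹ • (p - (adjoint R) u)) = u := by
  have hε' : (ε : ℂ) ^ 2 ≠ 0 := by simp [hε.ne']
  rw [map_smul, map_sub, ← hu, add_sub_cancel_left, smul_smul, inv_mul_cancel₀ hε', one_smul]

/-- With `U` the residual, pair `p = ε²U + R†u` with `U`; the second term is `⟪u, R U⟫ = ‖u‖²` by
`map_residual`. -/
theorem inner_residual {R : F →L[ℂ] E} {ε : ℝ} (hε : 0 < ε) {p : F} {u : E}
    (hu : R ((adjoint R) u) + (ε : ℂ) ^ 2 • u = R p) :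
    ⟪p, ((ε : ℂ) ^ 2)⁻¹ • (p - (adjoint R) u)⟫_ℂ =
      ((‖u‖ ^ 2 + ε ^ 2 * ‖((ε : ℂ) ^ 2)⁻¹ • (p - (adjoint R) u)‖ ^ 2 : ℝ) : ℂ) := by
  have hε' : (ε : ℂ) ^ 2 ≠ 0 := by simp [hε.ne']
  have hRU := map_residual hε hu
  set U := ((ε : ℂ) ^ 2)⁻¹ • (p - (adjoint R) u) with hU
  have hp : p = (ε : ℂ) ^ 2 • U + (adjoint R) u := by
    rw [hU, smul_smul, mul_inv_cancel₀ hε', one_smul, sub_add_cancel]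
  calc ⟪p, U⟫_ℂ = ⟪(ε : ℂ) ^ 2 • U + (adjoint R) u, U⟫_ℂ := by rw [← hp]
    _ = _ := by
      rw [inner_add_left, inner_smul_left, adjoint_inner_left, hRU, inner_self_eq_norm_sq_to_K,
        inner_self_eq_norm_sq_to_K]
      simp
      ring

theorem adjoint_apply_mem_ker_orthogonal (R : F →L[ℂ] E) (u : E) :
    (adjoint R) u ∈ (LinearMap.ker (R : F →ₗ[ℂ] E))ᗮ := by
  rw [Submodule.mem_orthogonal]
  intro g hg
  rw [adjoint_inner_right]
  have : R g = 0 := hg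
  rw [this, inner_zero_left]

section Eigenbasis

variable {ι : Type*} {R : F →L[ℂ] E} {e : HilbertBasis ι ℂ E} {lam : ι → ℝ}

theorem eigenvalue_eq_norm_sq (he : ∀ n, R ((adjoint R) (e n)) = (lam n : ℂ) • e n) (n : ι) :
    lam n = ‖(adjoint R) (e n)‖ ^ 2 := by
  have h1 : ⟪e n, R ((adjoint R) (e n))⟫_ℂ = lam n := by
    rw [he, inner_smul_right, inner_self_eq_norm_sq_to_K, e.orthonormal.1]; simp
  rw [← adjoint_inner_left, inner_self_eq_norm_sq_to_K] at h1
  have h2 : ((‖(adjoint R) (e n)‖ ^ 2 : ℝ) : ℂ) = lam n := by rw [← h1]; simp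
  exact_mod_cast h2.symm

theorem eigenvalue_pos (he : ∀ n, R ((adjoint R) (e n)) = (lam n : ℂ) • e n)
    (hinj : ∀ u, (adjoint R) u = 0 → u = 0) (n : ι) : 0 < lam n := by
  rw [eigenvalue_eq_norm_sq he]
  have : (adjoint R) (e n) ≠ 0 := fun h => e.orthonormal.ne_zero n (hinj _ h)
  positivity

theorem inner_basis_map_adjoint (he : ∀ n, R ((adjoint R) (e n)) = (lam n : ℂ) • e n) (u : E)
    (n : ι) :
    ⟪e n, R ((adjoint R) u)⟫_ℂ = lam n * ⟪e n, u⟫_ℂ := by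
  rw [← adjoint_inner_left, ← adjoint_inner_left, adjoint_adjoint, he, inner_smul_left,
    Complex.conj_ofReal]

/-- Parseval's formula in the orthogonal complement of the kernel, for the orthogonal system
`R† (e n)`. -/
theorem hasSum_inner_of_mem_ker_orthogonal (he : ∀ n, R ((adjoint R) (e n)) = (lam n : ℂ) • e n)
    (hpos : ∀ n, 0 < lam n) {f g : F} (hf : f ∈ (LinearMap.ker (R : F →ₗ[ℂ] E))ᗮ)
    (hg : g ∈ (LinearMap.ker (R : F →ₗ[ℂ] E))ᗮ) :
    HasSum (fun n => conj ⟪e n, R f⟫_ℂ * ⟪e n, R g⟫_ℂ / lam n) ⟪f, g⟫_ℂ := by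
  classical
  set V := (LinearMap.ker (R : F →ₗ[ℂ] E))ᗮ with hV
  have : CompleteSpace V := inferInstance
  have hsq : ∀ n, ((Real.sqrt (lam n) : ℝ) : ℂ) * (Real.sqrt (lam n) : ℝ) = lam n := fun n => by
    rw [← Complex.ofReal_mul, Real.mul_self_sqrt (hpos n).le]
  have hs0 : ∀ n, ((Real.sqrt (lam n) : ℝ) : ℂ) ≠ 0 := fun n => by
    simpa using (Real.sqrt_pos.2 (hpos n)).ne'
  set φ : ι → V := fun n =>
    ((Real.sqrt (lam n) : ℝ) : ℂ)⁻¹ • ⟨(adjoint R) (e n), adjoint_apply_mem_ker_orthogonal R _⟩ with hφ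
  have hφin : ∀ n (v : V), ⟪φ n, v⟫_ℂ = ((Real.sqrt (lam n) : ℝ) : ℂ)⁻¹ * ⟪e n, R v⟫_ℂ := by
    intro n v
    simp only [hφ, inner_smul_left, Submodule.coe_inner, adjoint_inner_left]
    rw [map_inv₀, Complex.conj_ofReal]
  have horth : Orthonormal ℂ φ := by
    rw [orthonormal_iff_ite]
    intro i j
    rw [hφin]
    simp only [hφ, Submodule.coe_smul, map_smul, he, inner_smul_right]
    rw [orthonormal_iff_ite.1 e.orthonormal]
    split_ifs with h
    · subst h
      rw [← hsq]
      field_simp [hs0 i]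
    · simp
  -- A vector of `V` orthogonal to every `R†(e n)` is killed by `R`, so it lies in both `ker R` and
  -- `(ker R)ᗮ`.
  have hbot : (Submodule.span ℂ (range φ))ᗮ = ⊥ := by
    rw [Submodule.eq_bot_iff]
    intro v hv
    have h1 : ∀ n, ⟪e n, R v⟫_ℂ = 0 := by
      intro n
      have := (Submodule.mem_orthogonal _ _).1 hv (φ n) (Submodule.subset_span ⟨n, rfl⟩)
      rw [hφin] at this
      exact (mul_eq_zero.1 this).resolve_left (inv_ne_zero (hs0 n))
    have h2 : R v = 0 := by
      apply e.repr.injective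
      ext n
      rw [e.repr_apply_apply, h1]; simp
    have h3 := (Submodule.mem_orthogonal _ _).1 v.2 (v : F) h2
    exact Subtype.ext (inner_self_eq_zero.1 h3)
  have hsum := (HilbertBasis.mkOfOrthogonalEqBot horth hbot).hasSum_inner_mul_inner
    (⟨f, hf⟩ : V) ⟨g, hg⟩
  rw [HilbertBasis.coe_mkOfOrthogonalEqBot] at hsum
  convert! hsum using 2 with n
  rw [← inner_conj_symm (⟨f, hf⟩ : V), hφin, hφin, map_mul, map_inv₀, Complex.conj_ofReal, ← hsq]
  field_simp [hs0 n]

/-- Picard's criterion: if `p` is not in the range of `R†`, then the Picard series diverges. -/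
theorem tsum_picard_eq_top (he : ∀ n, R ((adjoint R) (e n)) = (lam n : ℂ) • e n)
    (hpos : ∀ n, 0 < lam n) {p : F} (hp : p ∈ (LinearMap.ker (R : F →ₗ[ℂ] E))ᗮ)
    (hrange : ∀ v, (adjoint R) v ≠ p) :
    ∑' n, ENNReal.ofReal (‖⟪e n, R p⟫_ℂ‖ ^ 2 / lam n ^ 2) = ⊤ := by
  by_contra hne
  have hsum : Summable fun n => ‖⟪e n, R p⟫_ℂ‖ ^ 2 / lam n ^ 2 := by
    refine (ENNReal.summable_toReal hne).congr fun n => ?_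
    rw [ENNReal.toReal_ofReal (by positivity)]
  have hmem : Memℓp (fun n => ⟪e n, R p⟫_ℂ / lam n) 2 := by
    refine memℓp_gen (hsum.congr fun n => ?_)
    simp [div_pow]
  -- If the series converged, this `v` would satisfy `R R†v = R p`. As `R†v - p` also lies in `(ker
  -- R)ᗮ`, it would follow that `R†v = p`.
  set v : E := e.repr.symm ⟨_, hmem⟩ with hv
  have hcoef : ∀ n, ⟪e n, v⟫_ℂ = ⟪e n, R p⟫_ℂ / lam n := by
    intro n
    rw [← e.repr_apply_apply, hv, LinearIsometryEquiv.apply_symm_apply]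
  have h1 : R ((adjoint R) v) = R p := by
    apply e.repr.injective
    ext n
    rw [e.repr_apply_apply, e.repr_apply_apply, inner_basis_map_adjoint he, hcoef]
    have : (lam n : ℂ) ≠ 0 := by exact_mod_cast (hpos n).ne'
    field_simp
  have h2 : R ((adjoint R) v - p) = 0 := by rw [map_sub, h1, sub_self]
  have h3 : (adjoint R) v - p ∈ (LinearMap.ker (R : F →ₗ[ℂ] E))ᗮ :=
    Submodule.sub_mem _ (adjoint_apply_mem_ker_orthogonal R v) hp
  have h4 := (Submodule.mem_orthogonal _ _).1 h3 _ h2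
  exact hrange v (sub_eq_zero.1 (inner_self_eq_zero.1 h4))

theorem hasSum_norm_sq_of_mem_ker_orthogonal (he : ∀ n, R ((adjoint R) (e n)) = (lam n : ℂ) • e n)
    (hpos : ∀ n, 0 < lam n) {f : F} (hf : f ∈ (LinearMap.ker (R : F →ₗ[ℂ] E))ᗮ) :
    HasSum (fun n => ‖⟪e n, R f⟫_ℂ‖ ^ 2 / lam n) (‖f‖ ^ 2) := by
  have h := hasSum_inner_of_mem_ker_orthogonal he hpos hf hf
  rw [inner_self_eq_norm_sq_to_K] at h
  have h2 : HasSum (fun n => ((‖⟪e n, R f⟫_ℂ‖ ^ 2 / lam n : ℝ) : ℂ)) ((‖f‖ ^ 2 : ℝ) : ℂ) := by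
    convert! h using 2 with n
    · rw [Complex.conj_mul']; push_cast; rfl
    · push_cast; rfl
  exact_mod_cast h2

theorem inner_basis_regularized (he : ∀ n, R ((adjoint R) (e n)) = (lam n : ℂ) • e n)
    (hpos : ∀ n, 0 < lam n) {ε : ℝ} {p : F} {u : E}
    (hu : R ((adjoint R) u) + (ε : ℂ) ^ 2 • u = R p) (n : ι) :
    ⟪e n, u⟫_ℂ = ⟪e n, R p⟫_ℂ / ((lam n + ε ^ 2 : ℝ) : ℂ) := by
  have h0 : ((lam n + ε ^ 2 : ℝ) : ℂ) ≠ 0 := by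
    exact_mod_cast (add_pos_of_pos_of_nonneg (hpos n) (sq_nonneg ε)).ne'
  rw [eq_div_iff h0, ← hu, inner_add_right, inner_smul_right, inner_basis_map_adjoint he]
  push_cast
  ring

theorem hasSum_norm_sq_regularized (he : ∀ n, R ((adjoint R) (e n)) = (lam n : ℂ) • e n)
    (hpos : ∀ n, 0 < lam n) {ε : ℝ} {p : F} {u : E}
    (hu : R ((adjoint R) u) + (ε : ℂ) ^ 2 • u = R p) :
    HasSum (fun n => ‖⟪e n, R p⟫_ℂ‖ ^ 2 / (lam n + ε ^ 2) ^ 2) (‖u‖ ^ 2) := by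
  have h := e.hasSum_inner_mul_inner u u
  rw [inner_self_eq_norm_sq_to_K] at h
  have h2 : HasSum (fun n => ((‖⟪e n, R p⟫_ℂ‖ ^ 2 / (lam n + ε ^ 2) ^ 2 : ℝ) : ℂ))
      ((‖u‖ ^ 2 : ℝ) : ℂ) := by
    convert! h using 2 with n
    · rw [← inner_conj_symm u, Complex.conj_mul', inner_basis_regularized he hpos hu, norm_div,
        Complex.norm_real, Real.norm_eq_abs, ← Complex.ofReal_pow, div_pow, sq_abs]
    · push_cast; rfl
  exact_mod_cast h2

/-- Parseval in `(ker R)ᗮ` for the residual `U`: since `R U = u`, its coefficients are those of `u`.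
-/
theorem hasSum_norm_sq_residual (he : ∀ n, R ((adjoint R) (e n)) = (lam n : ℂ) • e n)
    (hpos : ∀ n, 0 < lam n) {ε : ℝ} (hε : 0 < ε) {p : F} {u : E}
    (hp : p ∈ (LinearMap.ker (R : F →ₗ[ℂ] E))ᗮ)
    (hu : R ((adjoint R) u) + (ε : ℂ) ^ 2 • u = R p) :
    HasSum (fun n => ‖⟪e n, R p⟫_ℂ‖ ^ 2 / (lam n * (lam n + ε ^ 2) ^ 2))
      (‖((ε : ℂ) ^ 2)⁻¹ • (p - (adjoint R) u)‖ ^ 2) := by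
  have hU := Submodule.smul_mem _ ((ε : ℂ) ^ 2)⁻¹
    (Submodule.sub_mem _ hp (adjoint_apply_mem_ker_orthogonal R u))
  convert! hasSum_norm_sq_of_mem_ker_orthogonal he hpos hU using 2 with n
  rw [map_residual hε hu, inner_basis_regularized he hpos hu, norm_div, Complex.norm_real,
    Real.norm_eq_abs, div_pow, sq_abs, div_div, mul_comm (lam n)]

theorem hasSum_inner_residual (he : ∀ n, R ((adjoint R) (e n)) = (lam n : ℂ) • e n)
    (hpos : ∀ n, 0 < lam n) {ε : ℝ} (hε : 0 < ε) {p : F} {u : E}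
    (hp : p ∈ (LinearMap.ker (R : F →ₗ[ℂ] E))ᗮ)
    (hu : R ((adjoint R) u) + (ε : ℂ) ^ 2 • u = R p) :
    HasSum (fun n => ((‖⟪e n, R p⟫_ℂ‖ ^ 2 / (lam n * (lam n + ε ^ 2)) : ℝ) : ℂ))
      ⟪p, ((ε : ℂ) ^ 2)⁻¹ • (p - (adjoint R) u)⟫_ℂ := by
  have hU := Submodule.smul_mem _ ((ε : ℂ) ^ 2)⁻¹
    (Submodule.sub_mem _ hp (adjoint_apply_mem_ker_orthogonal R u))
  convert! hasSum_inner_of_mem_ker_orthogonal he hpos hp hU using 2 with n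
  rw [map_residual hε hu, inner_basis_regularized he hpos hu, ← mul_div_assoc, Complex.conj_mul',
    div_div, mul_comm (lam n)]
  push_cast
  rfl

end Eigenbasis

end HilbertSpace

/-! ### The Cauchy kernel on the real line -/

section CauchyKernel

/-- Cauchy type integrals are holomorphic at points away from the poles. -/
theorem differentiableAt_integral_div_sub {α : Type*} [MeasurableSpace α] {μ : Measure α}
    {f φ : α → ℂ} (hf : Integrable f μ) (hφ : AEStronglyMeasurable φ μ) {w₀ : ℂ} {δ : ℝ}
    (hδ : 0 < δ) (hsep : ∀ᵐ x ∂μ, δ ≤ ‖w₀ - φ x‖) :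
    DifferentiableAt ℂ (fun w => ∫ x, f x / (w - φ x) ∂μ) w₀ := by
  have hmeas : ∀ w, AEStronglyMeasurable (fun x => f x / (w - φ x)) μ := fun w =>
    (hf.1.aemeasurable.div (aemeasurable_const.sub hφ.aemeasurable)).aestronglyMeasurable
  have hlow : ∀ x, δ ≤ ‖w₀ - φ x‖ → ∀ w ∈ Metric.ball w₀ (δ / 2), δ / 2 ≤ ‖w - φ x‖ := by
    intro x hx w hw
    have h1 : ‖w₀ - φ x‖ ≤ ‖w₀ - w‖ + ‖w - φ x‖ := norm_sub_le_norm_sub_add_norm_sub _ _ _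
    have h2 : ‖w₀ - w‖ < δ / 2 := by rw [norm_sub_rev]; simpa [dist_eq_norm] using hw
    linarith
  refine (hasDerivAt_integral_of_dominated_loc_of_deriv_le (μ := μ)
    (F := fun w x => f x / (w - φ x)) (F' := fun w x => -(f x / (w - φ x) ^ 2))
    (bound := fun x => ‖f x‖ * (4 / δ ^ 2))
    (Metric.ball_mem_nhds w₀ (half_pos hδ)) (Eventually.of_forall hmeas) ?_ ?_ ?_
    (hf.norm.mul_const _) ?_).2.differentiableAt
  · refine (hf.norm.mul_const δ⁻¹).mono' (hmeas w₀) ?_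
    filter_upwards [hsep] with x hx
    rw [norm_div, div_eq_mul_inv]
    gcongr
  · exact (hf.1.aemeasurable.div
      ((aemeasurable_const.sub hφ.aemeasurable).pow_const 2)).neg.aestronglyMeasurable
  · filter_upwards [hsep] with x hx w hw
    have := hlow x hx w hw
    rw [norm_neg, norm_div, norm_pow, div_eq_mul_inv]
    gcongr
    rw [show 4 / δ ^ 2 = ((δ / 2) ^ 2)⁻¹ by field_simp; norm_num]
    gcongr
  · filter_upwards [hsep] with x hx w hw
    have hne : w - φ x ≠ 0 := by
      rw [← norm_pos_iff]; linarith [hlow x hx w hw]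
    have := ((hasDerivAt_id w).sub_const (φ x)).fun_inv hne |>.const_mul (f x)
    simp only [id] at this
    convert! this using 1
    field_simp

/-- Allows every pole in a bounded set away from the real line to be dominated by one fixed `L²`
function, `1 / (x + i)`. -/
theorem norm_add_I_le {v : ℂ} {δ M : ℝ} (hδ : 0 < δ) (h1 : δ ≤ |v.im|) (h2 : ‖v‖ ≤ M) (x : ℝ) :
    ‖(x : ℂ) + Complex.I‖ ≤ (1 + (M + 1) / δ) * ‖(x : ℂ) - v‖ := by
  have h3 : δ ≤ ‖(x : ℂ) - v‖ := by
    refine h1.trans ?_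
    have := Complex.abs_im_le_norm ((x : ℂ) - v)
    simpa using this
  have hM : 0 ≤ M := (norm_nonneg v).trans h2
  calc ‖(x : ℂ) + Complex.I‖ = ‖((x : ℂ) - v) + (v + Complex.I)‖ := by ring_nf
    _ ≤ ‖(x : ℂ) - v‖ + (‖v‖ + ‖Complex.I‖) :=
      (norm_add_le _ _).trans (by gcongr; exact norm_add_le _ _)
    _ ≤ ‖(x : ℂ) - v‖ + (M + 1) := by rw [Complex.norm_I]; gcongr
    _ = ‖(x : ℂ) - v‖ + (M + 1) / δ * δ := by field_simp
    _ ≤ ‖(x : ℂ) - v‖ + (M + 1) / δ * ‖(x : ℂ) - v‖ := by gcongr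
    _ = _ := by ring

theorem add_I_ne_zero (x : ℝ) : (x : ℂ) + Complex.I ≠ 0 := fun h => by
  have := congrArg Complex.im h
  simp at this

theorem norm_inv_sub_le {v : ℂ} {δ M : ℝ} (hδ : 0 < δ) (h1 : δ ≤ |v.im|) (h2 : ‖v‖ ≤ M) (x : ℝ) :
    ‖((x : ℂ) - v)⁻¹‖ ≤ (1 + (M + 1) / δ) * ‖((x : ℂ) + Complex.I)⁻¹‖ := by
  have h := norm_add_I_le hδ h1 h2 x
  have hpos : 0 < ‖(x : ℂ) + Complex.I‖ := norm_pos_iff.2 (add_I_ne_zero x)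
  have h3 : 0 < ‖(x : ℂ) - v‖ := by
    refine norm_pos_iff.2 fun h0 => ?_
    rw [h0, norm_zero, mul_zero] at h
    linarith
  rw [norm_inv, norm_inv, inv_eq_one_div, ← div_eq_mul_inv, div_le_div_iff₀ h3 hpos]
  linarith

theorem memLp_inv_add_I : MemLp (fun x : ℝ => ((x : ℂ) + Complex.I)⁻¹) 2 volume := by
  have hm : Measurable fun x : ℝ => ((x : ℂ) + Complex.I)⁻¹ := by fun_prop
  rw [memLp_two_iff_integrable_sq_norm hm.aestronglyMeasurable]
  refine integrable_inv_one_add_sq.congr (Eventually.of_forall fun x => ?_)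
  simp only [norm_inv, inv_pow, Complex.sq_norm, Complex.normSq_apply]
  simp
  ring

theorem memLp_inv_sub {v : ℂ} (hv : v.im ≠ 0) : MemLp (fun x : ℝ => ((x : ℂ) - v)⁻¹) 2 volume := by
  have hm : Measurable fun x : ℝ => ((x : ℂ) - v)⁻¹ := by fun_prop
  exact memLp_inv_add_I.of_le_mul hm.aestronglyMeasurable
    (Eventually.of_forall (norm_inv_sub_le (abs_pos.2 hv) le_rfl le_rfl))

/-- Removes the divergent part `log x`, which cancels in the difference of two logarithms. -/
theorem tendsto_log_mul_sub_log {c : ℂ} (hc : c ∈ Complex.slitPlane) (d : ℂ) :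
    Tendsto (fun x : ℝ => Complex.log (x * c + d) - Real.log x) atTop (𝓝 (Complex.log c)) := by
  have h1 : Tendsto (fun x : ℝ => c + ((x⁻¹ : ℝ) : ℂ) * d) atTop (𝓝 (c + ((0 : ℝ) : ℂ) * d)) :=
    tendsto_const_nhds.add
      (((Complex.continuous_ofReal.tendsto 0).comp tendsto_inv_atTop_zero).mul_const d)
  rw [Complex.ofReal_zero, zero_mul, add_zero] at h1
  refine (h1.clog hc).congr' ?_
  filter_upwards [eventually_gt_atTop 0, h1.eventually_ne (Complex.slitPlane_ne_zero hc)]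
    with x hx hne
  have hx' : (x : ℂ) ≠ 0 := by exact_mod_cast hx.ne'
  rw [show (x : ℂ) * c + d = x * (c + ((x⁻¹ : ℝ) : ℂ) * d) by push_cast; field_simp,
    Complex.log_ofReal_mul hx hne]
  ring

/-- The integral of a product of a pole in the upper and a pole in the lower half-plane. -/
theorem integral_inv_sub_mul_inv_sub_conj {w v : ℂ} (hw : 0 < w.im) (hv : 0 < v.im) :
    ∫ x : ℝ, ((x : ℂ) - w)⁻¹ * ((x : ℂ) - conj v)⁻¹ =
      2 * Real.pi * Complex.I / (w - conj v) := by
  have hne : w - conj v ≠ 0 := fun h => by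
    have := congrArg Complex.im h
    simp at this
    linarith
  have hxw : ∀ x : ℝ, (x : ℂ) - w ≠ 0 := fun x h => by
    have := congrArg Complex.im h
    simp at this
    linarith
  have hxv : ∀ x : ℝ, (x : ℂ) - conj v ≠ 0 := fun x h => by
    have := congrArg Complex.im h
    simp at this
    linarith
  -- A primitive by partial fractions. The rotations by `i` and `-i` give both arguments positive
  -- real part, so the principal branch is smooth along the whole line.
  set A : ℝ → ℂ := fun x => (Complex.log (x * Complex.I + -(Complex.I * w)) -
    Complex.log (x * (-Complex.I) + Complex.I * conj v)) / (w - conj v) with hA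
  have hderiv : ∀ x : ℝ, HasDerivAt A (((x : ℂ) - w)⁻¹ * ((x : ℂ) - conj v)⁻¹) x := by
    intro x
    have h1 : HasDerivAt (fun x : ℝ => (x : ℂ) * Complex.I + -(Complex.I * w)) Complex.I x := by
      simpa using ((hasDerivAt_id x).ofReal_comp.mul_const Complex.I).add_const (-(Complex.I * w))
    have h2 : HasDerivAt (fun x : ℝ => (x : ℂ) * (-Complex.I) + Complex.I * conj v)
        (-Complex.I) x := by
      simpa using ((hasDerivAt_id x).ofReal_comp.mul_const (-Complex.I)).add_const
        (Complex.I * conj v)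
    have h3 := h1.clog_real (Or.inl (by simpa using hw))
    have h4 := h2.clog_real (Or.inl (by simpa using hv))
    convert! (h3.sub h4).div_const (w - conj v) using 1
    have e1 : (x : ℂ) * Complex.I + -(Complex.I * w) = Complex.I * (x - w) := by ring
    have e2 : (x : ℂ) * (-Complex.I) + Complex.I * conj v = -Complex.I * (x - conj v) := by ring
    rw [e1, e2]
    have := hxw x
    have := hxv x
    have hI := Complex.I_ne_zero
    field_simp
    ring
  have hint : Integrable fun x : ℝ => ((x : ℂ) - w)⁻¹ * ((x : ℂ) - conj v)⁻¹ :=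
    (memLp_inv_sub hw.ne').integrable_mul (memLp_inv_sub (by simpa using hv.ne'))
  have hIs : Complex.I ∈ Complex.slitPlane := Or.inr (by simp)
  have hIs' : -Complex.I ∈ Complex.slitPlane := Or.inr (by simp)
  have htop : Tendsto A atTop (𝓝 (Real.pi * Complex.I / (w - conj v))) := by
    have := ((tendsto_log_mul_sub_log hIs (-(Complex.I * w))).sub
      (tendsto_log_mul_sub_log hIs' (Complex.I * conj v))).div_const (w - conj v)
    rw [Complex.log_I, Complex.log_neg_I] at this
    convert! this using 2
    · simp only [hA]; ring
    · ring
  have hbot : Tendsto A atBot (𝓝 (-(Real.pi * Complex.I / (w - conj v)))) := by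
    have := ((tendsto_log_mul_sub_log hIs' (-(Complex.I * w))).sub
      (tendsto_log_mul_sub_log hIs (Complex.I * conj v))).div_const (w - conj v)
    rw [Complex.log_I, Complex.log_neg_I] at this
    rw [← tendsto_comp_neg_atTop_iff]
    convert! this using 2
    · simp only [hA, Complex.ofReal_neg]; ring_nf
    · ring
  rw [integral_of_hasDerivAt_of_tendsto hderiv hint hbot htop]
  ring

/-- The boundary values of `p_w` as an element of `L²(ℝ)`. -/
noncomputable def linePole (w : ℂ) : Lp ℂ 2 (volume : Measure ℝ) :=
  if h : w.im = 0 then 0 else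
    ((memLp_inv_sub (v := conj w) (by simpa using h)).const_mul Complex.I).toLp _

theorem coeFn_linePole {w : ℂ} (hw : 0 < w.im) :
    linePole w =ᵐ[volume] fun x : ℝ => poleFn w x := by
  rw [linePole, dif_neg hw.ne']
  refine (MemLp.coeFn_toLp _).trans (Eventually.of_forall fun x => ?_)
  simp [poleFn, div_eq_mul_inv]

theorem conj_poleFn (w ζ : ℂ) : conj (poleFn w ζ) = poleFn ζ w := by
  simp only [poleFn, map_div₀, Complex.conj_I, map_sub, Complex.conj_conj]
  rw [← neg_sub w (conj ζ), neg_div_neg_eq]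

theorem inner_linePole (g : Lp ℂ 2 (volume : Measure ℝ)) {w : ℂ} (hw : 0 < w.im) :
    inner ℂ (linePole w) g = ∫ x : ℝ, poleFn x w * g x := by
  rw [L2.inner_def]
  refine integral_congr_ae ?_
  filter_upwards [coeFn_linePole hw] with x hx
  rw [hx, RCLike.inner_apply, conj_poleFn, mul_comm]

theorem inner_linePole_linePole {w v : ℂ} (hw : 0 < w.im) (hv : 0 < v.im) :
    inner ℂ (linePole w) (linePole v) = 2 * Real.pi * poleFn v w := by
  rw [inner_linePole _ hw]
  have : ∀ᵐ x : ℝ, poleFn x w * linePole v x = ((x : ℂ) - w)⁻¹ * ((x : ℂ) - conj v)⁻¹ := by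
    filter_upwards [coeFn_linePole hv] with x hx
    rw [hx, poleFn, poleFn, Complex.conj_ofReal, ← neg_sub (x : ℂ) w]
    rw [div_eq_mul_inv, div_eq_mul_inv, inv_neg]
    linear_combination (-((x : ℂ) - w)⁻¹ * ((x : ℂ) - conj v)⁻¹) * Complex.I_mul_I
  rw [integral_congr_ae this, integral_inv_sub_mul_inv_sub_conj hw hv, poleFn]
  ring

theorem norm_linePole_sq {w : ℂ} (hw : 0 < w.im) : ‖linePole w‖ ^ 2 = Real.pi / w.im := by
  have h := inner_linePole_linePole hw hw
  rw [inner_self_eq_norm_sq_to_K] at h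
  have h2 : (2 * Real.pi * poleFn w w : ℂ) = ((Real.pi / w.im : ℝ) : ℂ) := by
    have hne : (w.im : ℂ) ≠ 0 := by exact_mod_cast hw.ne'
    rw [poleFn, Complex.sub_conj]
    push_cast
    field_simp
  refine Complex.ofReal_injective ?_
  rw [← h2, ← h]
  simp

theorem differentiableOn_inner_linePole (g : Lp ℂ 2 (volume : Measure ℝ)) :
    DifferentiableOn ℂ (fun w => inner ℂ (linePole w) g) {w | 0 < w.im} := by
  -- `g` itself need not be integrable, but `h` is, and `g / (w - x) = (w + i) h / (w - x) - h`
  -- reduces the claim to a Cauchy integral of `h`.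
  set h : ℝ → ℂ := fun x => ((x : ℂ) + Complex.I)⁻¹ * g x with hh
  have hint : Integrable h := memLp_inv_add_I.integrable_mul (Lp.memLp g)
  have hsep : ∀ w : ℂ, ∀ x : ℝ, w.im ≤ ‖w - x‖ := fun w x => by
    have := Complex.im_le_norm (w - x)
    simpa using this
  have hopen : IsOpen {w : ℂ | 0 < w.im} := isOpen_lt continuous_const Complex.continuous_im
  have hD : DifferentiableOn ℂ (fun w => Complex.I * ((w + Complex.I) * ∫ x : ℝ, h x / (w - x)) -
      Complex.I * ∫ x, h x) {w | 0 < w.im} := by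
    intro w hw
    have := differentiableAt_integral_div_sub (φ := fun x : ℝ => (x : ℂ)) hint
      (by fun_prop) (w₀ := w) hw (Eventually.of_forall (hsep w))
    exact DifferentiableAt.differentiableWithinAt (by fun_prop)
  refine hD.congr fun w hw => ?_
  have hw : 0 < w.im := hw
  have hne : ∀ x : ℝ, w - x ≠ 0 := fun x h0 => by
    have := hsep w x
    rw [h0, norm_zero] at this
    linarith
  have hint2 : Integrable fun x : ℝ => h x / (w - x) := by
    refine (hint.norm.mul_const (w.im)⁻¹).mono' ?_ (Eventually.of_forall fun x => ?_)
    · exact (hint.1.aemeasurable.div (by fun_prop)).aestronglyMeasurable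
    · rw [norm_div, div_eq_mul_inv]
      gcongr
      exact hsep w x
  rw [inner_linePole _ hw, ← integral_const_mul, ← integral_const_mul, ← integral_const_mul,
    ← integral_sub ((hint2.const_mul _).const_mul _) (hint.const_mul _)]
  congr 1
  ext x
  have h1 := hne x
  have h2 := add_I_ne_zero x
  simp only [hh, poleFn, Complex.conj_ofReal]
  field_simp
  ring

end CauchyKernel

/-! ### The restriction operator from `H²` and its adjoint -/

section Restriction

open ContinuousLinearMap

/-- `(𝒦 u)(ζ)` for the integral with respect to a measure `μ`. -/
noncomputable def cauchyOp (μ : Measure ℂ) (u : ℂ → ℂ) (ζ : ℂ) : ℂ :=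
  1 / (2 * (Real.pi : ℂ)) * ∫ τ, Complex.I * u τ / (ζ - conj τ) ∂μ

/-- The measure is finite and carried by a bounded subset of a half-plane `Im τ ≥ δ > 0`. -/
structure IsUpperBounded (μ : Measure ℂ) (δ M : ℝ) : Prop where
  finite : IsFiniteMeasure μ
  pos : 0 < δ
  ae_le : ∀ᵐ τ ∂μ, δ ≤ τ.im ∧ ‖τ‖ ≤ M

variable {μ : Measure ℂ} {δ M : ℝ}

theorem IsUpperBounded.ae_im_pos (h : IsUpperBounded μ δ M) : ∀ᵐ τ ∂μ, 0 < τ.im :=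
  h.ae_le.mono fun _ hτ => h.pos.trans_le hτ.1

theorem IsUpperBounded.restrict_eq (h : IsUpperBounded μ δ M) : μ.restrict {τ | 0 < τ.im} = μ :=
  Measure.restrict_eq_self_of_ae_mem h.ae_im_pos

/-- The value at `τ` of the `H²` projection of `g`, by the reproducing formula. -/
noncomputable def hardyEval (g : Lp ℂ 2 (volume : Measure ℝ)) (τ : ℂ) : ℂ :=
  1 / (2 * (Real.pi : ℂ)) * inner ℂ (linePole τ) g

theorem differentiableOn_hardyEval (g : Lp ℂ 2 (volume : Measure ℝ)) :
    DifferentiableOn ℂ (hardyEval g) {w | 0 < w.im} :=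
  (differentiableOn_inner_linePole g).const_mul _

theorem aestronglyMeasurable_hardyEval (h : IsUpperBounded μ δ M)
    (g : Lp ℂ 2 (volume : Measure ℝ)) : AEStronglyMeasurable (hardyEval g) μ := by
  rw [← h.restrict_eq]
  exact (differentiableOn_hardyEval g).continuousOn.aestronglyMeasurable
    (isOpen_lt continuous_const Complex.continuous_im).measurableSet

/-- Cauchy–Schwarz, with `‖linePole τ‖² = π / Im τ ≤ π / δ`. -/
theorem norm_hardyEval_le (h : IsUpperBounded μ δ M) (g : Lp ℂ 2 (volume : Measure ℝ)) :
    ∀ᵐ τ ∂μ, ‖hardyEval g τ‖ ≤ 1 / (2 * Real.pi) * Real.sqrt (Real.pi / δ) * ‖g‖ := by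
  filter_upwards [h.ae_le] with τ hτ
  have h1 : ‖linePole τ‖ ≤ Real.sqrt (Real.pi / δ) := by
    refine Real.le_sqrt_of_sq_le ?_
    rw [norm_linePole_sq (h.pos.trans_le hτ.1)]
    exact div_le_div_of_nonneg_left Real.pi_pos.le h.pos hτ.1
  rw [hardyEval, norm_mul, mul_assoc]
  have h2 : ‖1 / (2 * (Real.pi : ℂ))‖ = 1 / (2 * Real.pi) := by
    simp [abs_of_pos Real.pi_pos]
  rw [h2]
  gcongr
  exact (norm_inner_le_norm _ _).trans (by gcongr)

theorem memLp_hardyEval (h : IsUpperBounded μ δ M) (g : Lp ℂ 2 (volume : Measure ℝ)) :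
    MemLp (hardyEval g) 2 μ := by
  have := h.finite
  exact MemLp.of_bound (aestronglyMeasurable_hardyEval h g) _ (norm_hardyEval_le h g)

/-- The restriction operator `H² → L²(μ)`, precomposed with the projection `L²(ℝ) → H²`. -/
noncomputable def hardyRestrict (h : IsUpperBounded μ δ M) :
    Lp ℂ 2 (volume : Measure ℝ) →L[ℂ] Lp ℂ 2 μ :=
  LinearMap.mkContinuous
    { toFun := fun g => (memLp_hardyEval h g).toLp (hardyEval g)
      map_add' := fun f g => by
        rw [← MemLp.toLp_add]
        refine MemLp.toLp_congr _ _ (Eventually.of_forall fun τ => ?_)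
        simp only [hardyEval, inner_add_right, Pi.add_apply]
        ring
      map_smul' := fun c g => by
        rw [RingHom.id_apply, ← MemLp.toLp_const_smul]
        refine MemLp.toLp_congr _ _ (Eventually.of_forall fun τ => ?_)
        simp only [hardyEval, inner_smul_right, Pi.smul_apply, smul_eq_mul]
        ring }
    ((measureUnivNNReal μ : ℝ) ^ (2 : ℝ≥0∞).toReal⁻¹ *
      (1 / (2 * Real.pi) * Real.sqrt (Real.pi / δ)))
    (fun g => by
      have := h.finite
      have hle := Lp.norm_le_of_ae_bound (f := (memLp_hardyEval h g).toLp (hardyEval g))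
        (C := 1 / (2 * Real.pi) * Real.sqrt (Real.pi / δ) * ‖g‖) (by positivity) (by
          filter_upwards [(memLp_hardyEval h g).coeFn_toLp, norm_hardyEval_le h g] with τ h1 h2
          rwa [h1])
      rw [mul_assoc]
      exact hle)

theorem coeFn_hardyRestrict (h : IsUpperBounded μ δ M) (g : Lp ℂ 2 (volume : Measure ℝ)) :
    hardyRestrict h g =ᵐ[μ] hardyEval g :=
  (memLp_hardyEval h g).coeFn_toLp

theorem hardyEval_linePole {z τ : ℂ} (hz : 0 < z.im) (hτ : 0 < τ.im) :
    hardyEval (linePole z) τ = poleFn z τ := by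
  have : (Real.pi : ℂ) ≠ 0 := by exact_mod_cast Real.pi_ne_zero
  rw [hardyEval, inner_linePole_linePole hτ hz]
  field_simp

theorem coeFn_hardyRestrict_linePole (h : IsUpperBounded μ δ M) {z : ℂ} (hz : 0 < z.im) :
    hardyRestrict h (linePole z) =ᵐ[μ] poleFn z := by
  filter_upwards [coeFn_hardyRestrict h (linePole z), h.ae_im_pos] with τ h1 h2
  rw [h1, hardyEval_linePole hz h2]

/-- Moving the adjoint across pairs `u` with the restriction of `p_ζ`, and the conjugate of `p_ζ(τ)`
is the kernel of `𝒦` at `(ζ, τ)`. -/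
theorem hardyEval_adjoint (h : IsUpperBounded μ δ M) (u : Lp ℂ 2 μ) {ζ : ℂ} (hζ : 0 < ζ.im) :
    hardyEval (adjoint (hardyRestrict h) u) ζ = cauchyOp μ u ζ := by
  rw [hardyEval, adjoint_inner_right, cauchyOp, L2.inner_def]
  congr 1
  refine integral_congr_ae ?_
  filter_upwards [coeFn_hardyRestrict_linePole h hζ] with τ h1
  rw [h1, RCLike.inner_apply, conj_poleFn, poleFn]
  ring

theorem coeFn_hardyRestrict_adjoint (h : IsUpperBounded μ δ M) (u : Lp ℂ 2 μ) :
    hardyRestrict h (adjoint (hardyRestrict h) u) =ᵐ[μ] cauchyOp μ u := by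
  filter_upwards [coeFn_hardyRestrict h (adjoint (hardyRestrict h) u), h.ae_im_pos] with τ h1 h2
  rw [h1, hardyEval_adjoint h u h2]

theorem differentiableAt_cauchyOp {u : ℂ → ℂ} (hu : Integrable u μ) {ζ : ℂ} {r : ℝ} (hr : 0 < r)
    (hsep : ∀ᵐ τ ∂μ, r ≤ ‖ζ - conj τ‖) : DifferentiableAt ℂ (cauchyOp μ u) ζ :=
  (differentiableAt_integral_div_sub (hu.const_mul Complex.I)
    (by fun_prop) hr hsep).const_mul _

theorem IsUpperBounded.differentiableAt_cauchyOp (h : IsUpperBounded μ δ M) {u : ℂ → ℂ}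
    (hu : Integrable u μ) {ζ : ℂ} (hζ : 0 ≤ ζ.im) : DifferentiableAt ℂ (cauchyOp μ u) ζ := by
  refine _root_.differentiableAt_cauchyOp hu h.pos ?_
  filter_upwards [h.ae_le] with τ hτ
  have h1 := Complex.im_le_norm (ζ - conj τ)
  simp only [Complex.sub_im, Complex.conj_im, sub_neg_eq_add] at h1
  linarith [hτ.1]

/-- Moving up from the real line increases the distance to `conj v`, so `y = 0` is the worst case.
The uniformity in `y` yields the Hardy space bound. -/
theorem norm_inv_sub_conj_le {v : ℂ} (hδ : 0 < δ) (h1 : δ ≤ v.im) (h2 : ‖v‖ ≤ M) (x : ℝ) {y : ℝ}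
    (hy : 0 ≤ y) : ‖((x : ℂ) + y * Complex.I - conj v)⁻¹‖ ≤
      (1 + (M + 1) / δ) * ‖((x : ℂ) + Complex.I)⁻¹‖ := by
  refine le_trans ?_ (norm_inv_sub_le (v := conj v) hδ (h1.trans (by simpa using le_abs_self v.im))
    (by simpa using h2) x)
  have hne : 0 < ‖(x : ℂ) - conj v‖ := norm_pos_iff.2 fun h0 => by
    have := congrArg Complex.im h0
    simp at this
    linarith
  rw [norm_inv, norm_inv]
  refine inv_anti₀ hne ?_
  rw [← sq_le_sq₀ (norm_nonneg _) (norm_nonneg _), Complex.sq_norm, Complex.sq_norm,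
    Complex.normSq_apply, Complex.normSq_apply]
  simp
  nlinarith [hδ.le.trans h1]

theorem norm_cauchyOp_le (h : IsUpperBounded μ δ M) {u : ℂ → ℂ} (hu : Integrable u μ) (x : ℝ)
    {y : ℝ} (hy : 0 ≤ y) : ‖cauchyOp μ u ((x : ℂ) + y * Complex.I)‖ ≤
      (1 / (2 * Real.pi) * ((∫ τ, ‖u τ‖ ∂μ) * (1 + (M + 1) / δ))) *
        ‖((x : ℂ) + Complex.I)⁻¹‖ := by
  have h2 : ‖1 / (2 * (Real.pi : ℂ))‖ = 1 / (2 * Real.pi) := by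
    simp [abs_of_pos Real.pi_pos]
  rw [cauchyOp, norm_mul, h2, mul_assoc]
  gcongr
  rw [mul_assoc, ← integral_mul_const]
  refine norm_integral_le_of_norm_le (hu.norm.mul_const _) ?_
  filter_upwards [h.ae_le] with τ hτ
  rw [div_eq_mul_inv, norm_mul, norm_mul, Complex.norm_I, one_mul]
  gcongr
  exact norm_inv_sub_conj_le h.pos hτ.1 hτ.2 x hy

theorem memLp_cauchyOp (h : IsUpperBounded μ δ M) {u : ℂ → ℂ} (hu : Integrable u μ) :
    MemLp (fun x : ℝ => cauchyOp μ u x) 2 volume := by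
  have hcont : Continuous fun x : ℝ => cauchyOp μ u x := by
    rw [continuous_iff_continuousAt]
    intro x
    exact (h.differentiableAt_cauchyOp hu (by simp)).continuousAt.comp
      Complex.continuous_ofReal.continuousAt
  refine memLp_inv_add_I.of_le_mul hcont.aestronglyMeasurable (Eventually.of_forall fun x => ?_)
    (c := 1 / (2 * Real.pi) * ((∫ τ, ‖u τ‖ ∂μ) * (1 + (M + 1) / δ)))
  simpa using norm_cauchyOp_le h hu x le_rfl

/-- The adjoint of the restriction operator, read on the real line. -/
theorem coeFn_adjoint_hardyRestrict (h : IsUpperBounded μ δ M) (u : Lp ℂ 2 μ) :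
    adjoint (hardyRestrict h) u =ᵐ[volume] fun x : ℝ => cauchyOp μ u x := by
  have := h.finite
  have hu : Integrable u μ := (Lp.memLp u).integrable one_le_two
  suffices hs : adjoint (hardyRestrict h) u = (memLp_cauchyOp h hu).toLp _ by
    rw [hs]; exact MemLp.coeFn_toLp _
  -- The identity is tested against `g`; both pairings are the same double integral over `μ` and the
  -- line, in opposite orders.
  refine ext_inner_left ℂ fun g => ?_
  rw [adjoint_inner_right, L2.inner_def, L2.inner_def]
  have hm : AEStronglyMeasurable (fun p : ℂ × ℝ => u p.1 * conj (g p.2) *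
      (1 / (2 * (Real.pi : ℂ)) * (Complex.I / ((p.2 : ℂ) - conj p.1)))) (μ.prod volume) := by
    refine ((Lp.memLp u).1.comp_fst.mul
      (Complex.continuous_conj.comp_aestronglyMeasurable (Lp.memLp g).1.comp_snd)).mul
      (Measurable.aestronglyMeasurable ?_)
    fun_prop
  have hprod : Integrable (fun p : ℂ × ℝ => u p.1 * conj (g p.2) *
      (1 / (2 * (Real.pi : ℂ)) * (Complex.I / ((p.2 : ℂ) - conj p.1)))) (μ.prod volume) := by
    have hg : Integrable fun x : ℝ => ((x : ℂ) + Complex.I)⁻¹ * g x :=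
      memLp_inv_add_I.integrable_mul (Lp.memLp g)
    refine ((hu.norm.mul_prod hg.norm).mul_const (1 / (2 * Real.pi) * (1 + (M + 1) / δ))).mono'
      hm ?_
    have hae : ∀ᵐ p ∂(μ.prod (volume : Measure ℝ)), δ ≤ p.1.im ∧ ‖p.1‖ ≤ M :=
      Measure.quasiMeasurePreserving_fst.ae h.ae_le
    filter_upwards [hae] with p hp
    have h1 := norm_inv_sub_conj_le h.pos hp.1 hp.2 p.2 le_rfl
    simp only [Complex.ofReal_zero, zero_mul, add_zero] at h1
    have h2 : ‖1 / (2 * (Real.pi : ℂ))‖ = 1 / (2 * Real.pi) := by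
      simp [abs_of_pos Real.pi_pos]
    rw [norm_mul, norm_mul, norm_mul, h2, div_eq_mul_inv Complex.I, norm_mul, Complex.norm_I,
      one_mul, RCLike.norm_conj, norm_mul]
    calc _ ≤ ‖u p.1‖ * ‖g p.2‖ * (1 / (2 * Real.pi) *
        ((1 + (M + 1) / δ) * ‖((p.2 : ℂ) + Complex.I)⁻¹‖)) := by gcongr
      _ = _ := by ring
  have hswap := integral_integral_swap (f := fun τ x => u τ * conj (g x) *
      (1 / (2 * (Real.pi : ℂ)) * (Complex.I / ((x : ℂ) - conj τ)))) hprod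
  calc ∫ τ, inner ℂ (hardyRestrict h g τ) (u τ) ∂μ
      = ∫ τ, (∫ x : ℝ, u τ * conj (g x) *
          (1 / (2 * (Real.pi : ℂ)) * (Complex.I / ((x : ℂ) - conj τ)))) ∂μ := by
        refine integral_congr_ae ?_
        filter_upwards [coeFn_hardyRestrict h g, h.ae_im_pos] with τ h1 h2
        rw [h1, RCLike.inner_apply, hardyEval, inner_linePole _ h2, map_mul, ← integral_conj,
          ← integral_const_mul, ← integral_const_mul]
        congr 1
        ext x
        have h3 : conj (1 / (2 * (Real.pi : ℂ))) = 1 / (2 * (Real.pi : ℂ)) := by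
          rw [map_div₀, map_mul, map_one, map_ofNat, Complex.conj_ofReal]
        rw [map_mul, conj_poleFn, poleFn, h3]
        ring
    _ = ∫ x : ℝ, ∫ τ, u τ * conj (g x) *
          (1 / (2 * (Real.pi : ℂ)) * (Complex.I / ((x : ℂ) - conj τ))) ∂μ := hswap
    _ = _ := by
        refine integral_congr_ae ?_
        filter_upwards [(memLp_cauchyOp h hu).coeFn_toLp] with x h1
        rw [h1, RCLike.inner_apply, cauchyOp, ← integral_const_mul, ← integral_mul_const]
        congr 1
        ext τ
        ring

end Restriction

/-! ### Arc length measure and analytic continuation off the reflected arc -/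

namespace IsC1Arc

variable {γ : ℝ → ℂ} {a b : ℝ}

theorem continuousOn (h : IsC1Arc γ a b) : ContinuousOn γ (Icc a b) := h.contDiffOn.continuousOn

theorem isCompact_image (h : IsC1Arc γ a b) : IsCompact (γ '' Icc a b) :=
  isCompact_Icc.image_of_continuousOn h.continuousOn

theorem continuousOn_derivWithin (h : IsC1Arc γ a b) :
    ContinuousOn (derivWithin γ (Icc a b)) (Icc a b) :=
  h.contDiffOn.continuousOn_derivWithin (uniqueDiffOn_Icc h.lt) le_rfl

theorem aemeasurable_density (h : IsC1Arc γ a b) :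
    AEMeasurable (fun t => ENNReal.ofReal ‖derivWithin γ (Icc a b) t‖)
      (volume.restrict (Icc a b)) :=
  (h.continuousOn_derivWithin.norm.aemeasurable measurableSet_Icc).ennreal_ofReal

theorem aemeasurable (h : IsC1Arc γ a b) : AEMeasurable γ ((volume.restrict (Icc a b)).withDensity
    (fun t => ENNReal.ofReal ‖derivWithin γ (Icc a b) t‖)) :=
  (h.continuousOn.aemeasurable measurableSet_Icc).mono_ac (withDensity_absolutelyContinuous _ _)

theorem isFiniteMeasure (h : IsC1Arc γ a b) : IsFiniteMeasure (arcMeasure γ a b) := by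
  have : IsFiniteMeasure ((volume.restrict (Icc a b)).withDensity
      (fun t => ENNReal.ofReal ‖derivWithin γ (Icc a b) t‖)) :=
    isFiniteMeasure_withDensity_ofReal
      (h.continuousOn_derivWithin.norm.integrableOn_compact isCompact_Icc).2
  unfold arcMeasure
  infer_instance

theorem ae_mem_image (h : IsC1Arc γ a b) : ∀ᵐ τ ∂(arcMeasure γ a b), τ ∈ γ '' Icc a b := by
  unfold arcMeasure
  refine (ae_map_iff (p := fun τ => τ ∈ γ '' Icc a b) h.aemeasurable
    h.isCompact_image.isClosed.measurableSet).2 ?_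
  refine (withDensity_absolutelyContinuous _ _).ae_le ?_
  filter_upwards [ae_restrict_mem measurableSet_Icc] with t ht
  exact mem_image_of_mem γ ht

theorem arcMeasure_singleton (h : IsC1Arc γ a b) (c : ℂ) : arcMeasure γ a b {c} = 0 := by
  unfold arcMeasure
  rw [Measure.map_apply_of_aemeasurable h.aemeasurable (measurableSet_singleton c)]
  refine withDensity_absolutelyContinuous _ _ ?_
  rw [Measure.restrict_apply' measurableSet_Icc]
  refine Set.Subsingleton.measure_zero (fun s hs t ht => h.injOn hs.2 ht.2 ?_) _
  exact (show γ s = c from hs.1).trans (show γ t = c from ht.1).symm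

theorem arcMeasure_ne_zero (h : IsC1Arc γ a b) : arcMeasure γ a b ≠ 0 := by
  intro h0
  have h1 : arcMeasure γ a b univ = 0 := by rw [h0]; rfl
  unfold arcMeasure at h1
  rw [Measure.map_apply_of_aemeasurable h.aemeasurable MeasurableSet.univ, preimage_univ,
    withDensity_apply _ MeasurableSet.univ, Measure.restrict_univ,
    lintegral_eq_zero_iff' h.aemeasurable_density] at h1
  have h2 : ∀ᵐ t ∂(volume.restrict (Icc a b)), False := by
    filter_upwards [h1, ae_restrict_mem measurableSet_Icc] with t ht htI
    have := h.deriv_ne_zero t htI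
    simp at ht
    exact this ht
  rw [eventually_false_iff_eq_bot, ae_eq_bot, Measure.restrict_eq_zero, Real.volume_Icc] at h2
  simp at h2
  linarith [h.lt]

theorem infinite_of_ae_mem (h : IsC1Arc γ a b) {s : Set ℂ} (hs : ∀ᵐ τ ∂(arcMeasure γ a b), τ ∈ s) :
    s.Infinite := by
  intro hfin
  have h1 : arcMeasure γ a b s = 0 := by
    rw [← biUnion_of_singleton s, measure_biUnion_null_iff hfin.countable]
    exact fun c _ => h.arcMeasure_singleton c
  have h2 : ∀ᵐ τ ∂(arcMeasure γ a b), False := by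
    filter_upwards [hs, measure_eq_zero_iff_ae_notMem.1 h1] with τ h3 h4 using h4 h3
  rw [eventually_false_iff_eq_bot, ae_eq_bot] at h2
  exact h.arcMeasure_ne_zero h2

/-- The arc is the image of a real segment, a null set in the plane, under the map `w ↦ γ (Re w)`,
which is differentiable on that segment. -/
theorem volume_image (h : IsC1Arc γ a b) : volume (γ '' Icc a b) = 0 := by
  set s : Set ℂ := {w | w.re ∈ Icc a b ∧ w.im = 0} with hs
  have himg : γ '' Icc a b = (fun w : ℂ => γ w.re) '' s := by
    ext τ
    constructor
    · rintro ⟨t, ht, rfl⟩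
      exact ⟨t, ⟨by simpa using ht, by simp⟩, by simp⟩
    · rintro ⟨w, hw, rfl⟩
      exact ⟨w.re, hw.1, rfl⟩
  rw [himg]
  refine addHaar_image_eq_zero_of_differentiableOn_of_addHaar_eq_zero volume ?_ ?_
  · exact (h.contDiffOn.differentiableOn one_ne_zero).comp
      Complex.reCLM.differentiable.differentiableOn fun w hw => hw.1
  · refine measure_mono_null (fun w hw => ?_) (Measure.addHaar_submodule volume
      (LinearMap.ker Complex.imLm) ?_)
    · exact hw.2
    · intro htop
      have : Complex.I ∈ LinearMap.ker Complex.imLm := htop ▸ Submodule.mem_top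
      simp at this

/-- An arc in the upper half-plane carries a measure bounded away from the real line. -/
theorem exists_isUpperBounded (h : IsC1Arc γ a b) (hpos : ∀ t ∈ Icc a b, 0 < (γ t).im) :
    ∃ δ M, IsUpperBounded (arcMeasure γ a b) δ M := by
  obtain ⟨t₀, ht₀, hmin⟩ := isCompact_Icc.exists_isMinOn (nonempty_Icc.2 h.lt.le)
    (Complex.continuous_im.comp_continuousOn h.continuousOn)
  obtain ⟨M, hM⟩ := h.isCompact_image.isBounded.exists_norm_le
  refine ⟨(γ t₀).im, M, h.isFiniteMeasure, hpos t₀ ht₀, ?_⟩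
  filter_upwards [h.ae_mem_image] with τ hτ
  refine ⟨?_, hM τ hτ⟩
  obtain ⟨t, ht, rfl⟩ := hτ
  exact hmin ht

/-- A function holomorphic in the half-plane that vanishes almost everywhere on the arc is zero. -/
theorem eqOn_zero_of_ae_eq_zero (h : IsC1Arc γ a b) (hpos : ∀ t ∈ Icc a b, 0 < (γ t).im)
    {G : ℂ → ℂ} (hG : DifferentiableOn ℂ G {w | 0 < w.im})
    (hz : ∀ᵐ τ ∂(arcMeasure γ a b), G τ = 0) : EqOn G 0 {w | 0 < w.im} := by
  have hopen : IsOpen {w : ℂ | 0 < w.im} := isOpen_lt continuous_const Complex.continuous_im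
  -- Arc length is nonzero without atoms, so a set of full measure is infinite; by compactness the
  -- zeros accumulate on the arc, inside the half-plane.
  have hinf : ({τ | G τ = 0} ∩ γ '' Icc a b).Infinite :=
    h.infinite_of_ae_mem (hz.and h.ae_mem_image)
  obtain ⟨τ₀, hτ₀, hacc⟩ := hinf.exists_accPt_of_subset_isCompact h.isCompact_image
    inter_subset_right
  obtain ⟨t, ht, rfl⟩ := hτ₀
  refine (hG.analyticOnNhd hopen).eqOn_zero_of_preconnected_of_frequently_eq_zero
    (convex_halfSpace_im_gt 0).isPreconnected (hpos t ht) ?_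
  exact (accPt_iff_frequently_nhdsNE.1 hacc).mono fun w hw => hw.1

/-- The complement of the reflected arc is connected. -/
theorem isPreconnected_compl_conj (h : IsC1Arc γ a b) :
    IsPreconnected ((fun t => conj (γ t)) '' Icc a b)ᶜ :=
  isPreconnected_compl_arc h.lt.le (Complex.continuous_conj.comp_continuousOn h.continuousOn)
    fun _ hs _ ht hst => h.injOn hs ht ((starRingEnd ℂ).injective hst)

theorem isCompact_conj (h : IsC1Arc γ a b) : IsCompact ((fun t => conj (γ t)) '' Icc a b) :=
  isCompact_Icc.image_of_continuousOn (Complex.continuous_conj.comp_continuousOn h.continuousOn)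

theorem differentiableOn_cauchyOp (h : IsC1Arc γ a b) {u : ℂ → ℂ}
    (hu : Integrable u (arcMeasure γ a b)) :
    DifferentiableOn ℂ (cauchyOp (arcMeasure γ a b) u) ((fun t => conj (γ t)) '' Icc a b)ᶜ := by
  intro ζ hζ
  have hopen := h.isCompact_conj.isClosed.isOpen_compl
  obtain ⟨r, hr, hball⟩ := Metric.isOpen_iff.1 hopen ζ hζ
  refine (differentiableAt_cauchyOp hu hr ?_).differentiableWithinAt
  filter_upwards [h.ae_mem_image] with τ hτ
  by_contra hlt
  obtain ⟨t, ht, rfl⟩ := hτ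
  refine hball (a := conj (γ t)) ?_ ⟨t, ht, rfl⟩
  rw [Metric.mem_ball, dist_eq_norm, norm_sub_rev]
  exact not_le.1 hlt

/-- A function holomorphic off the reflected arc that vanishes in the upper half-plane is zero. -/
theorem eqOn_zero_compl_conj (h : IsC1Arc γ a b) (hpos : ∀ t ∈ Icc a b, 0 < (γ t).im) {G : ℂ → ℂ}
    (hG : DifferentiableOn ℂ G ((fun t => conj (γ t)) '' Icc a b)ᶜ)
    (hz : ∀ ζ : ℂ, 0 < ζ.im → G ζ = 0) : EqOn G 0 ((fun t => conj (γ t)) '' Icc a b)ᶜ := by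
  refine (hG.analyticOnNhd
    h.isCompact_conj.isClosed.isOpen_compl).eqOn_zero_of_preconnected_of_eventuallyEq_zero
    h.isPreconnected_compl_conj (z₀ := Complex.I) ?_ ?_
  · rintro ⟨t, ht, hI⟩
    have := congrArg Complex.im hI
    simp at this
    linarith [hpos t ht]
  · filter_upwards [(isOpen_lt continuous_const Complex.continuous_im).mem_nhds
      (show (0 : ℝ) < Complex.I.im by simp)] with ζ hζ using hz ζ hζ

/-- The operator `𝒦` determines its argument already by its values in the upper half-plane. -/
theorem ae_eq_zero_of_cauchyOp_eq_zero (h : IsC1Arc γ a b) (hpos : ∀ t ∈ Icc a b, 0 < (γ t).im)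
    {u : ℂ → ℂ} (hu : Integrable u (arcMeasure γ a b))
    (hz : ∀ ζ : ℂ, 0 < ζ.im → cauchyOp (arcMeasure γ a b) u ζ = 0) :
    u =ᵐ[arcMeasure γ a b] 0 := by
  have := h.isFiniteMeasure
  have h0 := h.eqOn_zero_compl_conj hpos (h.differentiableOn_cauchyOp hu) hz
  -- Conjugation turns the kernel `1 / (ζ - conj τ)` into the Cauchy kernel `1 / (w - τ)` with `w =
  -- conj ζ`.
  have hconj : Integrable (fun τ => conj (u τ)) (arcMeasure γ a b) :=
    hu.norm.mono' (Complex.continuous_conj.comp_aestronglyMeasurable hu.1) (by simp)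
  have h1 : ∀ w ∉ γ '' Icc a b, ∫ τ, conj (u τ) / (w - τ) ∂(arcMeasure γ a b) = 0 := by
    intro w hw
    have h2 : cauchyOp (arcMeasure γ a b) u (conj w) = 0 := by
      refine h0 ?_
      rintro ⟨t, ht, hI⟩
      exact hw ⟨t, ht, (starRingEnd ℂ).injective hI⟩
    rw [cauchyOp, mul_eq_zero] at h2
    have h3 := h2.resolve_left (by simp [Real.pi_ne_zero])
    have h4 : ∀ τ, Complex.I * u τ / (conj w - conj τ) =
        Complex.I * conj (conj (u τ) / (w - τ)) := fun τ => by
      simp only [map_div₀, map_sub, Complex.conj_conj]; ring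
    simp only [h4, integral_const_mul, integral_conj] at h3
    simpa using h3
  have h5 := ae_eq_zero_of_cauchyTransform_eq_zero hconj (by
    filter_upwards [measure_eq_zero_iff_ae_notMem.1 h.volume_image] with w hw using h1 w hw)
  filter_upwards [h5] with τ hτ
  simpa using hτ

end IsC1Arc

/-! ### The integral equation as a regularized normal equation -/

section Solution

open ContinuousLinearMap

variable {γ : ℝ → ℂ} {a b : ℝ} {δ M : ℝ}

theorem solvesEq_iff (hU : IsUpperBounded (arcMeasure γ a b) δ M) {z : ℂ} (hz : 0 < z.im) (ε : ℝ)
    (u : ArcL2 γ a b) : SolvesEq γ a b z ε u ↔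
      hardyRestrict hU (adjoint (hardyRestrict hU) u) + (ε : ℂ) ^ 2 • u =
        hardyRestrict hU (linePole z) := by
  rw [Lp.ext_iff]
  have h1 := coeFn_hardyRestrict_adjoint hU u
  have h2 := coeFn_hardyRestrict_linePole hU hz
  have h3 := Lp.coeFn_add (hardyRestrict hU (adjoint (hardyRestrict hU) u)) ((ε : ℂ) ^ 2 • u)
  have h4 := Lp.coeFn_smul ((ε : ℂ) ^ 2) u
  have h5 : ∀ᵐ ζ ∂(arcMeasure γ a b),
      (hardyRestrict hU (adjoint (hardyRestrict hU) u) + (ε : ℂ) ^ 2 • u : ArcL2 γ a b) ζ =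
        opK γ a b u ζ + (ε : ℂ) ^ 2 * u ζ := by
    filter_upwards [h1, h3, h4] with ζ e1 e3 e4
    rw [e3, Pi.add_apply, e4, e1]
    rfl
  constructor
  · intro h
    filter_upwards [h, h2, h5] with ζ e e2 e5
    rw [e5, e2, e]
  · intro h
    filter_upwards [h, h2, h5] with ζ e e2 e5
    rw [← e5, e, e2]

theorem isEigenbasis_iff (hU : IsUpperBounded (arcMeasure γ a b) δ M)
    (e : HilbertBasis ℕ ℂ (ArcL2 γ a b)) (lam : ℕ → ℝ) : IsEigenbasis γ a b e lam ↔
      ∀ n, hardyRestrict hU (adjoint (hardyRestrict hU) (e n)) = (lam n : ℂ) • e n := by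
  refine forall_congr' fun n => ?_
  rw [Lp.ext_iff]
  have h1 := coeFn_hardyRestrict_adjoint hU (e n)
  have h2 := Lp.coeFn_smul (lam n : ℂ) (e n)
  constructor
  · intro h
    filter_upwards [h, h1, h2] with ζ e e1 e2
    rw [e1, e2]
    exact e
  · intro h
    filter_upwards [h, h1, h2] with ζ e e1 e2
    rw [e1, e2] at e
    exact e

theorem poleCoeff_eq_inner (hU : IsUpperBounded (arcMeasure γ a b) δ M) {z : ℂ} (hz : 0 < z.im)
    (v : ArcL2 γ a b) : poleCoeff γ a b z v = inner ℂ v (hardyRestrict hU (linePole z)) := by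
  rw [poleCoeff, L2.inner_def]
  refine integral_congr_ae ?_
  filter_upwards [coeFn_hardyRestrict_linePole hU hz] with τ h1
  rw [h1, RCLike.inner_apply]

theorem integrable_arcL2 (hU : IsUpperBounded (arcMeasure γ a b) δ M) (u : ArcL2 γ a b) :
    Integrable u (arcMeasure γ a b) := by
  have := hU.finite
  exact (Lp.memLp u).integrable one_le_two

theorem differentiableAt_solutionExt (hU : IsUpperBounded (arcMeasure γ a b) δ M) {z : ℂ}
    (hz : 0 < z.im) (ε : ℝ) (u : ArcL2 γ a b) {ζ : ℂ} (hζ : 0 ≤ ζ.im) :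
    DifferentiableAt ℂ (solutionExt γ a b z ε u) ζ := by
  have h1 : DifferentiableAt ℂ (opK γ a b u) ζ :=
    hU.differentiableAt_cauchyOp (integrable_arcL2 hU u) hζ
  have h2 : ζ - conj z ≠ 0 := fun h0 => by
    have := congrArg Complex.im h0
    simp at this
    linarith
  have h3 : DifferentiableAt ℂ (poleFn z) ζ :=
    (differentiableAt_const _).div (by fun_prop) h2
  exact (h3.sub h1).div_const _

/-- All singularities lie strictly below the real line, so the extension is continuous at every real
point. -/
theorem boundaryValue_solutionExt (hU : IsUpperBounded (arcMeasure γ a b) δ M) {z : ℂ}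
    (hz : 0 < z.im) (ε : ℝ) (u : ArcL2 γ a b) (x : ℝ) :
    boundaryValue (solutionExt γ a b z ε u) x = solutionExt γ a b z ε u x := by
  have hc := (differentiableAt_solutionExt hU hz ε u (ζ := x) (by simp)).continuousAt
  have h1 : Tendsto (fun y : ℝ => (x : ℂ) + (y : ℂ) * Complex.I) (𝓝 0) (𝓝 (x : ℂ)) := by
    have : Continuous fun y : ℝ => (x : ℂ) + (y : ℂ) * Complex.I := by fun_prop
    simpa using this.tendsto 0
  exact (hc.tendsto.comp (h1.mono_left nhdsWithin_le_nhds)).limUnder_eq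

/-- The boundary function of the solution is the residual of the regularized equation. -/
theorem coeFn_residual (hU : IsUpperBounded (arcMeasure γ a b) δ M) {z : ℂ}
    (hz : 0 < z.im) (ε : ℝ) (u : ArcL2 γ a b) :
    (((ε : ℂ) ^ 2)⁻¹ • (linePole z - adjoint (hardyRestrict hU) u) :
      Lp ℂ 2 (volume : Measure ℝ)) =ᵐ[volume] boundaryValue (solutionExt γ a b z ε u) := by
  filter_upwards [Lp.coeFn_smul ((ε : ℂ) ^ 2)⁻¹ (linePole z - adjoint (hardyRestrict hU) u),
    Lp.coeFn_sub (linePole z) (adjoint (hardyRestrict hU) u), coeFn_linePole hz,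
    coeFn_adjoint_hardyRestrict hU u] with x h1 h2 h3 h4
  rw [h1, Pi.smul_apply, h2, Pi.sub_apply, h3, h4, boundaryValue_solutionExt hU hz, solutionExt,
    smul_eq_mul, div_eq_inv_mul]
  rfl

theorem hardyNorm_solutionExt (hU : IsUpperBounded (arcMeasure γ a b) δ M) {z : ℂ}
    (hz : 0 < z.im) (ε : ℝ) (u : ArcL2 γ a b) :
    hardyNorm (solutionExt γ a b z ε u) =
      ‖((ε : ℂ) ^ 2)⁻¹ • (linePole z - adjoint (hardyRestrict hU) u)‖ := by
  rw [hardyNorm, Lp.norm_def, eLpNorm_congr_ae (coeFn_residual hU hz ε u)]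

theorem solutionExt_eq_inner (hU : IsUpperBounded (arcMeasure γ a b) δ M) {z : ℂ}
    (hz : 0 < z.im) (ε : ℝ) (u : ArcL2 γ a b) :
    2 * (Real.pi : ℂ) * solutionExt γ a b z ε u z =
      inner ℂ (linePole z) (((ε : ℂ) ^ 2)⁻¹ • (linePole z - adjoint (hardyRestrict hU) u)) := by
  have h1 := hardyEval_adjoint hU u hz
  rw [hardyEval] at h1
  have hπ : (Real.pi : ℂ) ≠ 0 := by exact_mod_cast Real.pi_ne_zero
  rw [inner_smul_right, inner_sub_right, inner_linePole_linePole hz hz, solutionExt]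
  change 2 * (Real.pi : ℂ) * ((poleFn z z - cauchyOp (arcMeasure γ a b) u z) / (ε : ℂ) ^ 2) = _
  rw [← h1]
  field_simp

theorem memHardy_solutionExt (hU : IsUpperBounded (arcMeasure γ a b) δ M) {z : ℂ}
    (hz : 0 < z.im) (ε : ℝ) (u : ArcL2 γ a b) : MemHardy (solutionExt γ a b z ε u) := by
  refine ⟨fun ζ hζ => (differentiableAt_solutionExt hU hz ε u
    (le_of_lt hζ)).differentiableWithinAt, ?_⟩
  set C₁ : ℝ := 1 / (2 * Real.pi) * ((∫ τ, ‖u τ‖ ∂(arcMeasure γ a b)) * (1 + (M + 1) / δ))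
  set C₂ : ℝ := 1 + (‖z‖ + 1) / z.im
  set C : ℝ := (C₂ + C₁) / ‖(ε : ℂ) ^ 2‖
  set K : ℝ≥0∞ := ENNReal.ofReal C * eLpNorm (fun x : ℝ => ((x : ℂ) + Complex.I)⁻¹) 2 volume
  have hK : K ≠ ⊤ := ENNReal.mul_ne_top ENNReal.ofReal_ne_top memLp_inv_add_I.2.ne
  refine ⟨K.toNNReal, fun y hy => ?_⟩
  rw [ENNReal.coe_toNNReal hK]
  refine eLpNorm_le_mul_eLpNorm_of_ae_le_mul (Eventually.of_forall fun x => ?_) 2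
  have h1 := norm_cauchyOp_le hU (integrable_arcL2 hU u) x hy.le
  have h2 : ‖poleFn z ((x : ℂ) + y * Complex.I)‖ ≤ C₂ * ‖((x : ℂ) + Complex.I)⁻¹‖ := by
    rw [poleFn, div_eq_mul_inv, norm_mul, Complex.norm_I, one_mul]
    exact norm_inv_sub_conj_le hz le_rfl le_rfl x hy.le
  rw [solutionExt, norm_div, div_mul_eq_mul_div]
  refine div_le_div_of_nonneg_right ?_ (norm_nonneg _)
  rw [add_mul]
  exact (norm_sub_le _ _).trans (add_le_add h2 h1)

/-- For `g` in the kernel, `hardyEval g` vanishes almost everywhere on the arc, hence in the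
half-plane; its value at `z` is a multiple of the pairing with `linePole z`. -/
theorem linePole_mem_ker_orthogonal (hγ : IsC1Arc γ a b) (hpos : ∀ t ∈ Icc a b, 0 < (γ t).im)
    (hU : IsUpperBounded (arcMeasure γ a b) δ M) {z : ℂ} (hz : 0 < z.im) :
    linePole z ∈ (LinearMap.ker (hardyRestrict hU :
      Lp ℂ 2 (volume : Measure ℝ) →ₗ[ℂ] ArcL2 γ a b))ᗮ := by
  rw [Submodule.mem_orthogonal']
  intro g hg
  have hg0 : hardyRestrict hU g = 0 := hg
  have h1 : ∀ᵐ τ ∂(arcMeasure γ a b), hardyEval g τ = 0 := by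
    filter_upwards [coeFn_hardyRestrict hU g,
      Lp.coeFn_zero ℂ 2 (arcMeasure γ a b)] with τ e1 e2
    rw [← e1, hg0, e2, Pi.zero_apply]
  have h2 : hardyEval g z = 0 :=
    hγ.eqOn_zero_of_ae_eq_zero hpos (differentiableOn_hardyEval g) h1 hz
  rw [hardyEval, mul_eq_zero] at h2
  exact h2.resolve_left (by simp [Real.pi_ne_zero])

theorem adjoint_hardyRestrict_injective (hγ : IsC1Arc γ a b)
    (hpos : ∀ t ∈ Icc a b, 0 < (γ t).im) (hU : IsUpperBounded (arcMeasure γ a b) δ M)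
    (u : ArcL2 γ a b) (hu : adjoint (hardyRestrict hU) u = 0) : u = 0 := by
  refine Lp.ext ((hγ.ae_eq_zero_of_cauchyOp_eq_zero hpos (integrable_arcL2 hU u)
    fun ζ hζ => ?_).trans (Lp.coeFn_zero ℂ 2 (arcMeasure γ a b)).symm)
  rw [← hardyEval_adjoint hU u hζ, hu, hardyEval, inner_zero_right, mul_zero]

theorem adjoint_hardyRestrict_ne_linePole (hγ : IsC1Arc γ a b)
    (hpos : ∀ t ∈ Icc a b, 0 < (γ t).im) (hU : IsUpperBounded (arcMeasure γ a b) δ M)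
    {z : ℂ} (hz : 0 < z.im) (hzγ : z ∉ γ '' Icc a b) (u : ArcL2 γ a b) :
    adjoint (hardyRestrict hU) u ≠ linePole z := by
  intro hu
  -- Multiplying by `ζ - conj z` clears the pole. The resulting function vanishes in the half-plane,
  -- hence off the reflected arc, but at `conj z` it equals `-i`.
  have hD : DifferentiableOn ℂ
      (fun ζ => (ζ - conj z) * cauchyOp (arcMeasure γ a b) u ζ - Complex.I)
      ((fun t => conj (γ t)) '' Icc a b)ᶜ :=
    ((differentiableOn_id.sub_const _).mul
      (hγ.differentiableOn_cauchyOp (integrable_arcL2 hU u))).sub_const _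
  have h0 := hγ.eqOn_zero_compl_conj hpos hD fun ζ hζ => by
    have hne : ζ - conj z ≠ 0 := fun h0 => by
      have := congrArg Complex.im h0
      simp at this
      linarith
    rw [← hardyEval_adjoint hU u hζ, hu, hardyEval_linePole hz hζ, poleFn]
    field_simp
    ring
  have h1 := h0 (x := conj z) (by
    rintro ⟨t, ht, h⟩
    exact hzγ ⟨t, ht, (starRingEnd ℂ).injective h⟩)
  simp at h1

end Solution

theorem lemma4p1 (γ : ℝ → ℂ) (a b : ℝ) (hγ : IsC1Arc γ a b)
    (hpos : ∀ t ∈ Icc a b, 0 < (γ t).im)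
    (z : ℂ) (hz : 0 < z.im) (hzγ : z ∉ γ '' Icc a b) :
    -- the integral equation has exactly one solution in L²(Γ)
    (∀ ε : ℝ, 0 < ε → ∃! u : ArcL2 γ a b, SolvesEq γ a b z ε u) ∧
    -- the series, in any orthonormal eigenbasis of 𝒦
    (∀ (e : HilbertBasis ℕ ℂ (ArcL2 γ a b)) (lam : ℕ → ℝ), IsEigenbasis γ a b e lam →
      (∀ n, 0 < lam n) ∧
      HasSum (fun n => ‖poleCoeff γ a b z (e n)‖ ^ 2 / lam n) (Real.pi / z.im) ∧
      (∑' n, ENNReal.ofReal (‖poleCoeff γ a b z (e n)‖ ^ 2 / lam n ^ 2)) = ⊤ ∧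
      ∀ (ε : ℝ) (u : ArcL2 γ a b), 0 < ε → SolvesEq γ a b z ε u →
        HasSum (fun n =>
            ((‖poleCoeff γ a b z (e n)‖ ^ 2 / (lam n * (lam n + ε ^ 2)) : ℝ) : ℂ))
          (2 * (Real.pi : ℂ) * solutionExt γ a b z ε u z) ∧
        HasSum (fun n => ‖poleCoeff γ a b z (e n)‖ ^ 2 / (lam n + ε ^ 2) ^ 2) (‖u‖ ^ 2) ∧
        HasSum (fun n => ‖poleCoeff γ a b z (e n)‖ ^ 2 / (lam n * (lam n + ε ^ 2) ^ 2))
          (hardyNorm (solutionExt γ a b z ε u) ^ 2)) ∧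
    -- the consequence
    (∀ (ε : ℝ) (u : ArcL2 γ a b), 0 < ε → SolvesEq γ a b z ε u →
      MemHardy (solutionExt γ a b z ε u) ∧
      2 * (Real.pi : ℂ) * solutionExt γ a b z ε u z =
        ((‖u‖ ^ 2 + ε ^ 2 * hardyNorm (solutionExt γ a b z ε u) ^ 2 : ℝ) : ℂ)) := by
  obtain ⟨δ, M, hU⟩ := hγ.exists_isUpperBounded hpos
  have hp := linePole_mem_ker_orthogonal hγ hpos hU hz
  refine ⟨fun ε hε => ?_, fun e lam he => ?_, fun ε u hε hu => ?_⟩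
  · simp only [solvesEq_iff hU hz]
    exact existsUnique_regularized _ hε _
  · have he' := (isEigenbasis_iff hU e lam).1 he
    have hlam := eigenvalue_pos he' (adjoint_hardyRestrict_injective hγ hpos hU)
    simp only [poleCoeff_eq_inner hU hz]
    refine ⟨hlam, ?_, ?_, fun ε u hε hu => ?_⟩
    · rw [← norm_linePole_sq hz]
      exact hasSum_norm_sq_of_mem_ker_orthogonal he' hlam hp
    · exact tsum_picard_eq_top he' hlam hp
        (adjoint_hardyRestrict_ne_linePole hγ hpos hU hz hzγ)
    · have hu' := (solvesEq_iff hU hz ε u).1 hu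
      rw [solutionExt_eq_inner hU hz, hardyNorm_solutionExt hU hz]
      exact ⟨hasSum_inner_residual he' hlam hε hp hu', hasSum_norm_sq_regularized he' hlam hu',
        hasSum_norm_sq_residual he' hlam hε hp hu'⟩
  · have hu' := (solvesEq_iff hU hz ε u).1 hu
    refine ⟨memHardy_solutionExt hU hz ε u, ?_⟩
    rw [solutionExt_eq_inner hU hz, hardyNorm_solutionExt hU hz]
    exact inner_residual hε hu'
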